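/- Let $X$ be either the interval $I=[0,1)$ with the metric $|x-y|$, or the circle $\mathbb T=\mathbb R/\mathbb Z$ with its quotient metric $\min_{k\in\mathbb Z}|x-y-k|$, and let $\lambda$ be the uniform probability measure on $X$. For $p\in[1,\infty]$ and Borel probability measures $\mu,\nu$ on $X$ let $$W_p^X(\mu,\nu)=\inf_{\pi}\ \|d_X\|_{L^p(\pi)},$$ where $d_X$ is the metric and $\pi$ ranges over the measures on $X\times X$ with marginals $\mu$ and $\nu$. Let $q\in[1,\infty]$ be the Hölder conjugate of $p$, $\frac1p+\frac1q=1$, and let $$\|\mu-\lambda\|_{\dot W^{-1,p}(X)}=\sup\Big\{\int_X f\,d\mu-\int_X f\,d\lambda\ :\ f\colon X\to\mathbb R\text{ continuous with weak derivative } f',\ \|f'\|_{L^q(X)}\le 1\Big\}.$$ Here weak derivatives are defined by integration by parts against $C_c^\infty((0,1))$ if $X=I$, and against $C^\infty(\mathbb T)$ if $X=\mathbb T$. Then for every $p\in[1,\infty]$ and every Borel probability measure $\mu$ on $X$, $$W_p^X(\mu,\lambda)=\|\mu-\lambda\|_{\dot W^{-1,p}(X)}.$$ Moreover, if $X=I$,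 then $$\|\mu-\lambda\|_{\dot W^{-1,p}(I)}=\|D_\mu\|_{L^p(I)},\qquad D_\mu(x)=\mu([0,x))-x.$$ If $X=\mathbb T$, then $\mu-\lambda$ has an antiderivative, that is, an integrable $F\colon\mathbb T\to\mathbb R$ with distributional derivative $\mu-\lambda$, and for every such $F$ $$\|\mu-\lambda\|_{\dot W^{-1,p}(\mathbb T)}=\inf_{y\in\mathbb R}\|F-y\|_{L^p(\mathbb T)}.$$ -/

import Mathlib

open MeasureTheory
open scoped ENNReal ContDiff

namespace WassersteinSobolev

/-- The half-open unit interval `I = [0, 1)`, with the metric `|x - y|`. -/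
abbrev UnitIco : Type := Set.Ico (0 : ℝ) 1

/-- The uniform measure on `[0, 1)`: the restriction of Lebesgue measure. -/
noncomputable instance : MeasureSpace UnitIco := Measure.Subtype.measureSpace

/-- Couplings of `μ` and `ν`: measures on `X × X` with marginals `μ` and `ν`
(so probability measures whenever `μ` and `ν` are). -/
def IsCoupling {X : Type*} [MeasurableSpace X] (π : Measure (X × X)) (μ ν : Measure X) : Prop :=
  π.map Prod.fst = μ ∧ π.map Prod.snd = ν

/-- The Wasserstein-`p` distance: the infimum over couplings `π` of `‖d_X‖_{L^p(π)}`. -/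
noncomputable def wasserstein {X : Type*} [PseudoMetricSpace X] [MeasurableSpace X]
    (p : ℝ≥0∞) (μ ν : Measure X) : ℝ≥0∞ :=
  ⨅ (π : Measure (X × X)) (_ : IsCoupling π μ ν), eLpNorm (fun z : X × X => dist z.1 z.2) p π

/-- `g` is a weak derivative of `f` on `[0, 1)`: both are locally integrable on `(0, 1)`, and
integration by parts holds against all smooth functions with compact support in `(0, 1)`. -/
def HasWeakDerivIco (f g : UnitIco → ℝ) : Prop :=
  LocallyIntegrableOn f {x : UnitIco | 0 < (x : ℝ)} volume ∧
  LocallyIntegrableOn g {x : UnitIco | 0 < (x : ℝ)} volume ∧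
  ∀ φ : ℝ → ℝ, ContDiff ℝ ∞ φ → HasCompactSupport φ → tsupport φ ⊆ Set.Ioo 0 1 →
    ∫ x : UnitIco, f x * deriv φ x = -∫ x : UnitIco, g x * φ x

/-- `φ` is a smooth function on the circle `ℝ / ℤ`, with derivative `φ'`. -/
def IsSmoothWithDerivCircle (φ φ' : UnitAddCircle → ℝ) : Prop :=
  ContDiff ℝ ∞ (fun x : ℝ => φ (x : UnitAddCircle)) ∧
  ∀ x : ℝ, HasDerivAt (fun y : ℝ => φ (y : UnitAddCircle)) (φ' (x : UnitAddCircle)) x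

/-- `g` is a weak derivative of `f` on the circle: both are locally integrable, and integration
by parts holds against all smooth functions on the circle. -/
def HasWeakDerivCircle (f g : UnitAddCircle → ℝ) : Prop :=
  LocallyIntegrable f volume ∧ LocallyIntegrable g volume ∧
  ∀ φ φ' : UnitAddCircle → ℝ, IsSmoothWithDerivCircle φ φ' →
    ∫ x : UnitAddCircle, f x * φ' x = -∫ x : UnitAddCircle, g x * φ x

/-- The homogeneous Sobolev seminorm `‖f'‖_{L^q(X)}`, where `D f g` says that `g` is a weak
derivative of `f`. Weak derivatives are unique almost everywhere, so the infimum is over a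
constant; it is `∞` if `f` has no weak derivative. -/
noncomputable def sobolevSeminorm {X : Type*} [MeasureSpace X] (D : (X → ℝ) → (X → ℝ) → Prop)
    (q : ℝ≥0∞) (f : X → ℝ) : ℝ≥0∞ :=
  ⨅ (g : X → ℝ) (_ : D f g), eLpNorm g q volume

/-- The homogeneous negative Sobolev norm of `μ - λ`, where `λ` is the uniform measure `volume`:
the supremum of `∫ f d(μ - λ)` over all `f` with `‖f'‖_{L^q(X)} ≤ 1`, where `1/p + 1/q = 1`.
A function with weak derivative in `L^q` is taken to be its continuous representative, since the
integral against `μ` depends on the representative. The supremum is nonnegative (take `f = 0`),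
so that nothing is lost by `ENNReal.ofReal`. -/
noncomputable def negSobolevNorm {X : Type*} [TopologicalSpace X] [MeasureSpace X]
    (D : (X → ℝ) → (X → ℝ) → Prop) (p : ℝ≥0∞) (μ : Measure X) : ℝ≥0∞ :=
  ⨆ (f : X → ℝ) (_ : Continuous f) (_ : sobolevSeminorm D (ENNReal.conjExponent p) f ≤ 1),
    ENNReal.ofReal ((∫ x, f x ∂μ) - ∫ x, f x)

/-- `‖μ - λ‖` in the homogeneous negative Sobolev space of the interval `[0, 1)`. -/
noncomputable def negSobolevNormIco (p : ℝ≥0∞) (μ : Measure UnitIco) : ℝ≥0∞ :=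
  negSobolevNorm HasWeakDerivIco p μ

/-- `‖μ - λ‖` in the homogeneous negative Sobolev space of the circle `ℝ / ℤ`. -/
noncomputable def negSobolevNormCircle (p : ℝ≥0∞) (μ : Measure UnitAddCircle) : ℝ≥0∞ :=
  negSobolevNorm HasWeakDerivCircle p μ

/-- The discrepancy function `x ↦ μ([0, x)) - x` on `[0, 1)`. -/
noncomputable def discrepancy (μ : Measure UnitIco) (x : UnitIco) : ℝ :=
  μ.real {y : UnitIco | y < x} - (x : ℝ)

/-- `F` is an antiderivative of `μ - λ` on the circle: an integrable function whose
distributional derivative is `μ - λ`. -/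
def IsAntiderivCircle (F : UnitAddCircle → ℝ) (μ : Measure UnitAddCircle) : Prop :=
  Integrable F volume ∧
  ∀ φ φ' : UnitAddCircle → ℝ, IsSmoothWithDerivCircle φ φ' →
    ∫ x : UnitAddCircle, F x * φ' x =
      -((∫ x : UnitAddCircle, φ x ∂μ) - ∫ x : UnitAddCircle, φ x)

end WassersteinSobolev

/-! Let `Φ` be the distribution function of `μ`, extended to the line by `Φ (x + 1) = Φ x + 1`, let
`T` be its generalized inverse (the quantile function), and let `D = Φ - id`, which is periodic.
Both `W_p` and the negative Sobolev norm are shown to equal `‖D - y‖_p` with `y = 0` on the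
interval, and its infimum over `y` on the circle, where rotations make the shift `y` free.

Upper bounds. The map `u ↦ T (u + y)` transports `λ` to `μ` (for `y = 0` on the interval).
Integrating the weight `r |s - u| ^ (r - 1)` over the region between the graph of `Φ - y` and the
diagonal, in either order, shows that its cost is `‖D - y‖_r ^ r` (`InversePair.lintegral_rpow_eq`).
For the Sobolev norm, Fubini gives `∫ f d(μ - λ) = -∫ D f'` (`integral_sub_integral_primitive`). On
the circle `f'` has mean zero, so `D` may be replaced by `D - y`, and Hölder applies.

Lower bounds, for `1 < r < ∞`. One function serves both: `k = sgn (D - y) |D - y| ^ (r - 1)`. A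
primitive of `-r k` is a Kantorovich potential that certifies the optimality of `T`
(`InversePair.potential_add_le`), and a normalized primitive of `-k` is the extremal Sobolev test
function. On the circle these primitives must be periodic, so `y` is chosen by the intermediate
value theorem to make `k` of mean zero. This is the Euler-Lagrange equation for the best constant
`y`.

Endpoints. As `r → ∞`, compactness of the set of shifts gives `p = ∞`. For `p = 1`, the same
potentials give `‖D - y‖_r ^ r ≤ 2 ^ (r - 1) A(1)`, with `A(1)` either quantity at `p = 1`, and `r ↓
1` (`iInf_eLpNorm_sub_le`). -/

namespace WassersteinSobolev

/-! ### Generalized inverses commuting with integer translations -/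

/-- `Φ` and `T` are generalized inverses of each other, and `Φ` commutes with the translation
by `1`. -/
structure InversePair (Φ T : ℝ → ℝ) : Prop where
  add_one : ∀ x, Φ (x + 1) = Φ x + 1
  lt_iff : ∀ u x, T u < x ↔ u < Φ x

namespace InversePair

variable {Φ T : ℝ → ℝ}

theorem monotone_left (h : InversePair Φ T) : Monotone Φ := by
  intro x x' hx
  by_contra! hlt
  have := (h.lt_iff (Φ x') x).2 hlt
  exact lt_irrefl _ ((h.lt_iff _ _).1 (this.trans_le hx))

theorem monotone_right (h : InversePair Φ T) : Monotone T := by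
  intro u u' hu
  by_contra! hlt
  have := (h.lt_iff u' (T u)).1 hlt
  exact lt_irrefl _ ((h.lt_iff _ _).2 (hu.trans_lt this))

theorem right_add_one (h : InversePair Φ T) (u : ℝ) : T (u + 1) = T u + 1 := by
  refine eq_of_forall_gt_iff fun x => ?_
  have h1 := h.add_one (x - 1)
  rw [sub_add_cancel] at h1
  rw [h.lt_iff, ← lt_sub_iff_add_lt (a := T u), h.lt_iff, h1, lt_sub_iff_add_lt.symm]
  constructor <;> intro <;> linarith

theorem translate (h : InversePair Φ T) (y : ℝ) :
    InversePair (fun x => Φ x - y) (fun u => T (u + y)) where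
  add_one x := by rw [h.add_one]; ring
  lt_iff u x := by rw [h.lt_iff, lt_sub_iff_add_lt]

theorem periodic_sub (h : InversePair Φ T) : Function.Periodic (fun s => s - Φ s) 1 := by
  intro s
  simp only [h.add_one]
  ring

theorem abs_sub_le (h : InversePair Φ T) (s : ℝ) : |s - Φ s| ≤ 1 + |Φ 0| := by
  obtain ⟨t, ht, hst⟩ := h.periodic_sub.exists_mem_Ico₀ one_pos s
  rw [show s - Φ s = t - Φ t from hst]
  have h0 := h.monotone_left ht.1
  have h1 := h.monotone_left ht.2.le
  have h2 := h.add_one 0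
  rw [zero_add] at h2
  have := neg_abs_le (Φ 0)
  have := le_abs_self (Φ 0)
  rw [abs_le]
  constructor <;> linarith [ht.1, ht.2]

end InversePair

/-! ### The cost as a weighted area between a graph and the diagonal -/

/-- Exchange of the order of integration over a fundamental domain of the diagonal translations. -/
theorem lintegral_lintegral_diagonal_periodic (K : ℝ → ℝ → ℝ≥0∞)
    (hK : Measurable (Function.uncurry K)) (hper : ∀ u s, K (u + 1) (s + 1) = K u s) :
    ∫⁻ u in Set.Ioc (0 : ℝ) 1, ∫⁻ s, K u s = ∫⁻ s in Set.Ioc (0 : ℝ) 1, ∫⁻ u, K u s := by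
  have hfd : IsAddFundamentalDomain (AddSubgroup.zmultiples (1 : ℝ)) (Set.Ioc (0 : ℝ) (0 + 1))
    volume := isAddFundamentalDomain_Ioc one_pos 0 volume
  rw [zero_add] at hfd
  have hzn : ∀ (n : ℕ) (u s : ℝ), K (u + n) (s + n) = K u s := by
    intro n
    induction n with
    | zero => simp
    | succ n ih =>
      intro u s
      rw [← ih u s, ← hper (u + n) (s + n)]
      push_cast
      simp only [add_assoc]
  have hz : ∀ (n : ℤ) (u s : ℝ), K (u + n) (s + n) = K u s := by
    intro n u s
    obtain ⟨m, rfl | rfl⟩ := n.eq_nat_or_neg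
    · exact_mod_cast hzn m u s
    · rw [← hzn m]
      simp
  have hg : ∀ (g : AddSubgroup.zmultiples (1 : ℝ)) (u s : ℝ),
      K u (-g +ᵥ s) = K (g +ᵥ u) s := by
    rintro ⟨g, hg⟩ u s
    obtain ⟨n, rfl⟩ := AddSubgroup.mem_zmultiples_iff.1 hg
    rw [← hz n u]
    congr 1
    · simp [AddSubgroup.vadd_def, add_comm]
    · simp [AddSubgroup.vadd_def, add_comm]
  have hm : ∀ g : AddSubgroup.zmultiples (1 : ℝ),
      Measurable (Function.uncurry fun u s => K (g +ᵥ u) s) := by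
    intro g
    exact hK.comp (((measurable_const_vadd g).comp measurable_fst).prodMk measurable_snd)
  -- The inner integral over the line splits into integer translates of `(0, 1]`. Diagonal
  -- invariance moves each translation from `s` to `u`, and after Tonelli the sum refolds into an
  -- integral over all `u`.
  calc ∫⁻ u in Set.Ioc (0 : ℝ) 1, ∫⁻ s, K u s
      = ∫⁻ u in Set.Ioc (0 : ℝ) 1, ∑' g : AddSubgroup.zmultiples (1 : ℝ),
          ∫⁻ s in Set.Ioc (0 : ℝ) 1, K (g +ᵥ u) s := by
        refine lintegral_congr fun u => ?_
        rw [hfd.lintegral_eq_tsum']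
        simp only [hg]
    _ = ∑' g : AddSubgroup.zmultiples (1 : ℝ), ∫⁻ u in Set.Ioc (0 : ℝ) 1,
          ∫⁻ s in Set.Ioc (0 : ℝ) 1, K (g +ᵥ u) s := by
        rw [lintegral_tsum]
        exact fun g => ((hm g).lintegral_prod_right').aemeasurable
    _ = ∑' g : AddSubgroup.zmultiples (1 : ℝ), ∫⁻ s in Set.Ioc (0 : ℝ) 1,
          ∫⁻ u in Set.Ioc (0 : ℝ) 1, K (g +ᵥ u) s := by
        refine tsum_congr fun g => ?_
        rw [lintegral_lintegral_swap]
        exact (hm g).aemeasurable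
    _ = ∫⁻ s in Set.Ioc (0 : ℝ) 1, ∑' g : AddSubgroup.zmultiples (1 : ℝ),
          ∫⁻ u in Set.Ioc (0 : ℝ) 1, K (g +ᵥ u) s := by
        rw [lintegral_tsum]
        intro g
        exact ((hm g).lintegral_prod_left').aemeasurable
    _ = ∫⁻ s in Set.Ioc (0 : ℝ) 1, ∫⁻ u, K u s := by
        refine lintegral_congr fun s => ?_
        rw [hfd.lintegral_eq_tsum'' (fun u => K u s)]

/-- A layer-cake formula for powers of the distance. -/
theorem lintegral_uIoc_rpow {r : ℝ} (hr : 1 ≤ r) (a b : ℝ) :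
    ∫⁻ s in Set.uIoc a b, ENNReal.ofReal (r * |s - a| ^ (r - 1)) =
      ENNReal.ofReal (|b - a| ^ r) := by
  have hr0 : 0 < r := by linarith
  have key : ∀ c : ℝ, 0 ≤ c → ∫⁻ v in Set.Ioc 0 c, ENNReal.ofReal (r * |v| ^ (r - 1)) =
      ENNReal.ofReal (c ^ r) := by
    intro c hc
    have hint : IntervalIntegrable (fun v : ℝ => r * |v| ^ (r - 1)) volume 0 c := by
      refine Continuous.intervalIntegrable ?_ _ _
      exact continuous_const.mul (continuous_abs.rpow_const fun x => Or.inr (by linarith))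
    rw [← ofReal_integral_eq_lintegral_ofReal, ← intervalIntegral.integral_of_le hc]
    · have : ∫ v in (0 : ℝ)..c, r * |v| ^ (r - 1) = ∫ v in (0 : ℝ)..c, r * v ^ (r - 1) := by
        refine intervalIntegral.integral_congr fun v hv => ?_
        rw [Set.uIcc_of_le hc] at hv
        simp only [abs_of_nonneg hv.1]
      rw [this, intervalIntegral.integral_const_mul, integral_rpow (Or.inl (by linarith)),
        sub_add_cancel, Real.zero_rpow hr0.ne', sub_zero, mul_div_cancel₀ _ hr0.ne']
    · exact (intervalIntegrable_iff_integrableOn_Ioc_of_le hc).1 hint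
    · exact Filter.Eventually.of_forall fun v => by positivity
  rcases le_total a b with hab | hab
  · rw [Set.uIoc_of_le hab, abs_of_nonneg (sub_nonneg.2 hab), ← key _ (sub_nonneg.2 hab)]
    have := (measurePreserving_sub_right volume a).setLIntegral_comp_preimage_emb
      (measurableEmbedding_subRight a) (fun v => ENNReal.ofReal (r * |v| ^ (r - 1)))
      (Set.Ioc 0 (b - a))
    simpa using this
  -- The reflection `s ↦ a - s` swaps the open and the closed end, so both intervals are first
  -- replaced by closed ones.
  · rw [Set.uIoc_of_ge hab, abs_of_nonpos (sub_nonpos.2 hab), ← key _ (by linarith),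
      setLIntegral_congr (Ioc_ae_eq_Icc (μ := volume) (a := b) (b := a)),
      setLIntegral_congr (Ioc_ae_eq_Icc (μ := volume) (a := 0) (b := -(b - a)))]
    have := (Measure.measurePreserving_sub_left volume a).setLIntegral_comp_preimage_emb
      (measurableEmbedding_subLeft a) (fun v => ENNReal.ofReal (r * |v| ^ (r - 1)))
      (Set.Icc 0 (-(b - a)))
    simpa [abs_sub_comm] using this

/-- Both sides are the weighted area of one region, the points `(u, s)` between the diagonal and the
graph of `Φ`. Its sections are the intervals between `u` and `T u`, or between `s` and `Φ s`, and
the weight integrates over each to a power of its length. The region is invariant under `(1, 1)`,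
which allows the exchange of integrals over one period. -/
theorem InversePair.lintegral_rpow_eq {Φ T : ℝ → ℝ} (h : InversePair Φ T) {r : ℝ} (hr : 1 ≤ r) :
    ∫⁻ u in Set.Ioc (0 : ℝ) 1, ENNReal.ofReal (|T u - u| ^ r) =
      ∫⁻ s in Set.Ioc (0 : ℝ) 1, ENNReal.ofReal (|Φ s - s| ^ r) := by
  have hΦ : Measurable Φ := h.monotone_left.measurable
  -- Strict and weak inequalities are placed so that `lt_iff` makes the sections at fixed `u`
  -- exactly `uIoc u (T u)`; those at fixed `s` agree with `uIoc s (Φ s)` only up to endpoints.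
  let S : Set (ℝ × ℝ) := {z | (z.1 < z.2 ∧ Φ z.2 ≤ z.1) ∨ (z.1 < Φ z.2 ∧ z.2 ≤ z.1)}
  have hS : MeasurableSet S := by
    have h2 : Measurable fun z : ℝ × ℝ => Φ z.2 := hΦ.comp measurable_snd
    exact ((measurableSet_lt measurable_fst measurable_snd).inter
      (measurableSet_le h2 measurable_fst)).union
      ((measurableSet_lt measurable_fst h2).inter
      (measurableSet_le measurable_snd measurable_fst))
  let κ : ℝ × ℝ → ℝ≥0∞ := fun z => ENNReal.ofReal (r * |z.2 - z.1| ^ (r - 1))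
  have hκ : Measurable κ := by fun_prop
  have hsec1 : ∀ u, {s | (u, s) ∈ S} = Set.uIoc u (T u) := by
    intro u
    ext s
    have e : u < Φ s ↔ T u < s := (h.lt_iff u s).symm
    have e' : Φ s ≤ u ↔ s ≤ T u := by rw [← not_lt, e, not_lt]
    simp only [S, Set.mem_ofPred_eq, Set.mem_uIoc, e, e']
  have hsec2 : ∀ s, {u | (u, s) ∈ S} =ᵐ[volume] Set.uIoc s (Φ s) := by
    intro s
    have : {u | (u, s) ∈ S} = Set.Ico (min s (Φ s)) (max s (Φ s)) := by
      ext u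
      simp only [S, Set.mem_ofPred_eq, Set.mem_Ico, min_le_iff, lt_max_iff]
      constructor
      · rintro (⟨h1, h2⟩ | ⟨h1, h2⟩) <;> simp [h1, h2]
      · rintro ⟨h1, h2⟩
        by_cases h3 : u < s
        · exact Or.inl ⟨h3, h1.resolve_left (not_le.2 h3)⟩
        · exact Or.inr ⟨h2.resolve_left h3, not_lt.1 h3⟩
    rw [this]
    exact Ico_ae_eq_Ioc
  have key := lintegral_lintegral_diagonal_periodic (fun u s => S.indicator κ (u, s))
    (hκ.indicator hS) (by
      intro u s
      have : ((u + 1, s + 1) ∈ S) = ((u, s) ∈ S) := by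
        simp only [S, Set.mem_ofPred_eq, h.add_one, add_lt_add_iff_right, add_le_add_iff_right]
      by_cases hm : (u, s) ∈ S
      · rw [Set.indicator_of_mem hm, Set.indicator_of_mem (this.symm ▸ hm)]
        simp [κ]
      · rw [Set.indicator_of_notMem hm, Set.indicator_of_notMem (this.symm ▸ hm)])
  have h1 : ∀ u, ∫⁻ s, S.indicator κ (u, s) = ENNReal.ofReal (|T u - u| ^ r) := by
    intro u
    rw [← lintegral_uIoc_rpow hr u (T u), ← lintegral_indicator measurableSet_uIoc, ← hsec1 u]
    rfl
  have h2 : ∀ s, ∫⁻ u, S.indicator κ (u, s) = ENNReal.ofReal (|Φ s - s| ^ r) := by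
    intro s
    rw [← lintegral_uIoc_rpow hr s (Φ s), ← setLIntegral_congr (hsec2 s),
      ← lintegral_indicator (show MeasurableSet {u | (u, s) ∈ S} from measurable_prodMk_right hS)]
    refine lintegral_congr fun u => ?_
    simp only [Set.indicator, Set.mem_ofPred_eq, κ, abs_sub_comm]
  simpa only [h1, h2] using key

/-! ### Kantorovich potentials and weak duality -/

/-- The signed power `sgn(v) |v| ^ (r - 1)`, so that `r * signedPow r` is the derivative
of `|v| ^ r`. -/
noncomputable def signedPow (r v : ℝ) : ℝ := |v| ^ (r - 2) * v

theorem signedPow_of_nonneg {r v : ℝ} (hr : 1 < r) (hv : 0 ≤ v) : signedPow r v = v ^ (r - 1) := by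
  rcases hv.eq_or_lt with rfl | hv
  · simp [signedPow, Real.zero_rpow (sub_pos.2 hr).ne']
  · rw [signedPow, abs_of_pos hv, ← Real.rpow_add_one hv.ne']
    congr 1
    ring

theorem signedPow_neg (r v : ℝ) : signedPow r (-v) = -signedPow r v := by
  simp [signedPow]

theorem signedPow_monotone {r : ℝ} (hr : 1 < r) : Monotone (signedPow r) := by
  refine monotone_of_odd_of_monotoneOn_nonneg (signedPow_neg r) ?_
  intro v hv w hw hvw
  rw [signedPow_of_nonneg hr hv, signedPow_of_nonneg hr hw]
  exact Real.rpow_le_rpow hv hvw (by linarith)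

theorem abs_signedPow {r : ℝ} (hr : 1 < r) (v : ℝ) : |signedPow r v| = |v| ^ (r - 1) := by
  rcases le_total 0 v with hv | hv
  · rw [signedPow_of_nonneg hr hv, abs_of_nonneg hv, abs_of_nonneg (by positivity)]
  · rw [← neg_neg v, signedPow_neg, abs_neg, abs_neg, signedPow_of_nonneg hr (neg_nonneg.2 hv),
      abs_of_nonneg (neg_nonneg.2 hv), abs_of_nonneg (Real.rpow_nonneg (neg_nonneg.2 hv) _)]

theorem mul_signedPow {r : ℝ} (hr : 1 < r) (v : ℝ) : v * signedPow r v = |v| ^ r := by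
  rcases eq_or_ne v 0 with rfl | hv
  · simp [Real.zero_rpow (by linarith : r ≠ 0)]
  · have : v * signedPow r v = |v| ^ (r - 2) * |v| ^ (2 : ℝ) := by
      rw [signedPow, Real.rpow_two, sq_abs]
      ring
    rw [this, ← Real.rpow_add (abs_pos.2 hv)]
    congr 1
    ring

theorem hasDerivAt_abs_rpow_signedPow {r : ℝ} (hr : 1 < r) (v : ℝ) :
    HasDerivAt (fun v : ℝ => |v| ^ r) (r * signedPow r v) v := by
  simpa only [signedPow, mul_assoc] using hasDerivAt_abs_rpow v hr

/-- For `r < 2` the factor `|v| ^ (r - 2)` is singular at `0`, so continuity is read off from `|v| ^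
r` being continuously differentiable. -/
theorem continuous_signedPow {r : ℝ} (hr : 1 < r) : Continuous (signedPow r) := by
  have h := (contDiff_norm_rpow (E := ℝ) hr).continuous_deriv le_rfl
  have h2 : deriv (fun v : ℝ => ‖v‖ ^ r) = fun v => r * signedPow r v :=
    funext fun v => (hasDerivAt_abs_rpow_signedPow hr v).deriv
  rw [h2] at h
  have h3 := h.const_mul r⁻¹
  simpa [← mul_assoc, inv_mul_cancel₀ (by linarith : r ≠ 0)] using h3

namespace InversePair

variable {Φ T : ℝ → ℝ}

/-- The Kantorovich potential of the map `T` for the cost `|x - u| ^ r`. -/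
noncomputable def potential (Φ : ℝ → ℝ) (r x : ℝ) : ℝ :=
  ∫ s in (0 : ℝ)..x, r * signedPow r (s - Φ s)

theorem intervalIntegrable_signedPow (h : InversePair Φ T) {r : ℝ} (hr : 1 < r) (a b : ℝ) :
    IntervalIntegrable (fun s => r * signedPow r (s - Φ s)) volume a b := by
  have hm : Measurable fun s => signedPow r (s - Φ s) :=
    (continuous_signedPow hr).measurable.comp
      (measurable_id.sub h.monotone_left.measurable)
  refine IntervalIntegrable.const_mul ?_ r
  refine (intervalIntegrable_const (c := (1 + |Φ 0|) ^ (r - 1))).mono_fun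
    hm.aestronglyMeasurable ?_
  refine Filter.Eventually.of_forall fun s => ?_
  simp only [Real.norm_eq_abs]
  rw [abs_signedPow hr, abs_of_nonneg (by positivity : 0 ≤ (1 + |Φ 0|) ^ (r - 1))]
  exact Real.rpow_le_rpow (abs_nonneg _) (h.abs_sub_le s) (by linarith)

theorem continuous_potential (h : InversePair Φ T) {r : ℝ} (hr : 1 < r) :
    Continuous (potential Φ r) :=
  intervalIntegral.continuous_primitive (fun a b => h.intervalIntegrable_signedPow hr a b) 0

/-- The increment over a period is `r` times the integral in `h0`. Periodicity is what lets the
potential descend to the circle. -/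
theorem potential_periodic (h : InversePair Φ T) {r : ℝ} (hr : 1 < r)
    (h0 : ∫ s in (0 : ℝ)..1, signedPow r (s - Φ s) = 0) :
    Function.Periodic (potential Φ r) 1 := by
  intro x
  have hp : Function.Periodic (fun s => r * signedPow r (s - Φ s)) 1 := by
    intro s
    have := h.periodic_sub s
    simp only at this
    simp only [this]
  have h1 := hp.intervalIntegral_add_eq x 0
  rw [zero_add, intervalIntegral.integral_const_mul, intervalIntegral.integral_const_mul, h0,
    mul_zero, ← intervalIntegral.integral_const_mul] at h1
  rw [potential, potential, ← intervalIntegral.integral_add_adjacent_intervals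
    (h.intervalIntegrable_signedPow hr 0 x) (h.intervalIntegrable_signedPow hr x (x + 1)), h1,
    add_zero]

/-- Optimality of the potential: its `c`-concavity inequality, with equality for `x = T u`. -/
theorem potential_add_le (h : InversePair Φ T) {r : ℝ} (hr : 1 < r) (x u : ℝ) :
    potential Φ r x + (|T u - u| ^ r - potential Φ r (T u)) ≤ |x - u| ^ r := by
  have hint : ∀ a b : ℝ, IntervalIntegrable (fun s => r * signedPow r (s - u)) volume a b :=
    fun a b => (((continuous_signedPow hr).comp (continuous_id.sub continuous_const)).const_mul
      r).intervalIntegrable a b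
  have hftc : ∀ a b : ℝ, ∫ s in a..b, r * signedPow r (s - u) = |b - u| ^ r - |a - u| ^ r := by
    intro a b
    refine intervalIntegral.integral_eq_sub_of_hasDerivAt (f := fun s => |s - u| ^ r)
      (fun s _ => ?_) (hint a b)
    exact (hasDerivAt_abs_rpow_signedPow hr (s - u)).comp_sub_const s u
  have hφ : potential Φ r x - potential Φ r (T u) =
      ∫ s in (T u)..x, r * signedPow r (s - Φ s) :=
    intervalIntegral.integral_interval_sub_left (h.intervalIntegrable_signedPow hr _ _)
      (h.intervalIntegrable_signedPow hr _ _)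
  -- Both increments from `T u` to `x` are now integrals, with `Φ s` in one and `u` in the other.
  -- Beyond `T u` one has `u < Φ s`, and up to `T u` one has `Φ s ≤ u`, so monotonicity of
  -- `signedPow` gives the inequality for either orientation.
  suffices ∫ s in (T u)..x, r * signedPow r (s - Φ s) ≤ ∫ s in (T u)..x, r * signedPow r (s - u) by
    rw [hftc] at this
    linarith
  rcases le_total (T u) x with hx | hx
  · refine intervalIntegral.integral_mono_on_of_le_Ioo hx (h.intervalIntegrable_signedPow hr _ _)
      (hint _ _) fun s hs => ?_
    have := (h.lt_iff u s).1 hs.1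
    exact mul_le_mul_of_nonneg_left (signedPow_monotone hr (by linarith)) (by linarith)
  · rw [intervalIntegral.integral_symm, intervalIntegral.integral_symm x, neg_le_neg_iff]
    refine intervalIntegral.integral_mono_on_of_le_Ioo hx (hint _ _)
      (h.intervalIntegrable_signedPow hr _ _) fun s hs => ?_
    have : Φ s ≤ u := not_lt.1 fun hlt => absurd ((h.lt_iff u s).2 hlt) (not_lt.2 hs.2.le)
    exact mul_le_mul_of_nonneg_left (signedPow_monotone hr (by linarith)) (by linarith)

/-- There is a translate of `Φ` for which the potential is periodic. -/
theorem exists_integral_signedPow_eq_zero (h : InversePair Φ T) {r : ℝ} (hr : 1 < r) :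
    ∃ y, |y| ≤ 1 + |Φ 0| ∧ ∫ s in (0 : ℝ)..1, signedPow r (s - (Φ s - y)) = 0 := by
  set C := 1 + |Φ 0|
  have hC : 0 ≤ C := by positivity
  let J : ℝ → ℝ := fun y => ∫ s in (0 : ℝ)..1, signedPow r (s - (Φ s - y))
  have hc : ContinuousOn J (Set.Icc (-C) C) := by
    intro y hy
    refine intervalIntegral.continuousWithinAt_of_dominated_interval
      (bound := fun _ => (2 * C) ^ (r - 1)) ?_ ?_ ?_ ?_
    · refine Filter.Eventually.of_forall fun y => ?_
      exact ((continuous_signedPow hr).measurable.comp (measurable_id.sub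
        (h.monotone_left.measurable.sub_const y))).aestronglyMeasurable
    · refine eventually_nhdsWithin_of_forall fun y hy => Filter.Eventually.of_forall fun s _ => ?_
      rw [Real.norm_eq_abs, abs_signedPow hr]
      refine Real.rpow_le_rpow (abs_nonneg _) ?_ (by linarith)
      have h1 := abs_le.1 (h.abs_sub_le s)
      rw [abs_le]
      constructor <;> linarith [hy.1, hy.2]
    · exact intervalIntegrable_const
    · refine Filter.Eventually.of_forall fun s _ => Continuous.continuousWithinAt ?_
      exact (continuous_signedPow hr).comp (by fun_prop)
  -- At `y = -C` and `y = C` the argument `s - Φ s + y` has constant sign, because `|s - Φ s| ≤ C`.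
  have hneg : J (-C) ≤ 0 := by
    rw [← neg_nonneg, ← intervalIntegral.integral_neg]
    refine intervalIntegral.integral_nonneg zero_le_one fun s _ => ?_
    rw [← signedPow_neg]
    have h1 := abs_le.1 (h.abs_sub_le s)
    rw [signedPow_of_nonneg hr (by linarith)]
    exact Real.rpow_nonneg (by linarith) _
  have hpos : 0 ≤ J C := by
    refine intervalIntegral.integral_nonneg zero_le_one fun s _ => ?_
    have h1 := abs_le.1 (h.abs_sub_le s)
    rw [signedPow_of_nonneg hr (by linarith)]
    exact Real.rpow_nonneg (by linarith) _
  obtain ⟨y, hy, hy0⟩ := intermediate_value_Icc (by linarith) hc ⟨hneg, hpos⟩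
  exact ⟨y, abs_le.2 hy, hy0⟩

end InversePair

/-- Weak duality: a dual pair of potentials bounds the cost of every coupling from below. -/
theorem integral_le_integral_of_isCoupling {X : Type*} [MeasurableSpace X] {μ ν : Measure X}
    [IsProbabilityMeasure μ] [IsProbabilityMeasure ν] {π : Measure (X × X)}
    (hπ : IsCoupling π μ ν) {τ : X → X} (hτ : MeasurePreserving τ ν μ) {φ e : X → ℝ}
    {c : X × X → ℝ} (hφ : Integrable φ μ) (he : Integrable e ν) (hc : Integrable c π)
    (hle : ∀ x u, φ x + (e u - φ (τ u)) ≤ c (x, u)) :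
    ∫ u, e u ∂ν ≤ ∫ z, c z ∂π := by
  have h1 : MeasurePreserving Prod.fst π μ := ⟨measurable_fst, hπ.1⟩
  have h2 : MeasurePreserving Prod.snd π ν := ⟨measurable_snd, hπ.2⟩
  have hφτ : Integrable (fun u => φ (τ u)) ν := hτ.integrable_comp_of_integrable hφ
  have he' : Integrable (fun u => e u - φ (τ u)) ν := he.sub hφτ
  have i1 : Integrable (fun z : X × X => φ z.1) π := h1.integrable_comp_of_integrable hφ
  have i2 : Integrable (fun z : X × X => e z.2 - φ (τ z.2)) π :=
    h2.integrable_comp_of_integrable he'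
  have e1 : ∫ z, φ z.1 ∂π = ∫ x, φ x ∂μ := by
    rw [← hπ.1, integral_map measurable_fst.aemeasurable]
    rw [hπ.1]
    exact hφ.1
  have e2 : ∫ z, (e z.2 - φ (τ z.2)) ∂π = ∫ u, (e u - φ (τ u)) ∂ν := by
    rw [← hπ.2, integral_map measurable_snd.aemeasurable]
    rw [hπ.2]
    exact he'.1
  have e3 : ∫ u, φ (τ u) ∂ν = ∫ x, φ x ∂μ := by
    rw [← hτ.map_eq, integral_map hτ.measurable.aemeasurable]
    rw [hτ.map_eq]
    exact hφ.1
  -- Since `τ` carries `ν` to `μ`, the integrals of `φ` and `φ ∘ τ` cancel, leaving that of `e`.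
  calc ∫ u, e u ∂ν = ∫ z, (φ z.1 + (e z.2 - φ (τ z.2))) ∂π := by
        rw [integral_add i1 i2, e1, e2, integral_sub he hφτ, e3]
        ring
    _ ≤ ∫ z, c z ∂π := integral_mono (i1.add i2) hc fun z => hle z.1 z.2

/-! ### Distribution and quantile functions -/

/-- The distribution function of a probability measure on `[0, 1)`, extended to the real line
so that it commutes with integer translations. -/
noncomputable def quasiCdf (m : Measure ℝ) (x : ℝ) : ℝ :=
  ⌈x⌉ - 1 + m.real (Set.Iio (x - ⌈x⌉ + 1))

/-- The quantile function of a probability measure on `[0, 1)`, extended to the real line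
so that it commutes with integer translations. -/
noncomputable def quasiQuantile (m : Measure ℝ) (u : ℝ) : ℝ :=
  sSup {x | quasiCdf m x ≤ u}

theorem measure_eq_zero_of_disjoint_Ico {m : Measure ℝ} (hm : m (Set.Ico 0 1)ᶜ = 0) {s : Set ℝ}
    (hs : Disjoint s (Set.Ico 0 1)) : m s = 0 :=
  measure_mono_null (Set.subset_compl_iff_disjoint_right.2 hs) hm

section

variable {m : Measure ℝ} [IsProbabilityMeasure m]

theorem measure_eq_one_of_Ico_subset (hm : m (Set.Ico 0 1)ᶜ = 0) {s : Set ℝ}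
    (hs : Set.Ico 0 1 ⊆ s) : m s = 1 := by
  refine le_antisymm prob_le_one ?_
  rw [← (prob_compl_eq_zero_iff measurableSet_Ico).1 hm]
  exact measure_mono hs

theorem quasiCdf_eq (hm : m (Set.Ico 0 1)ᶜ = 0) {x : ℝ} (hx : x ∈ Set.Icc (0 : ℝ) 1) :
    quasiCdf m x = m.real (Set.Iio x) := by
  rcases hx.1.eq_or_lt with rfl | h0
  -- At `0` the ceiling drops to `0`, and the defining formula reads `-1 + m (Iio 1)`.
  · have h1 : m.real (Set.Iio 1) = 1 := by
      rw [measureReal_def, measure_eq_one_of_Ico_subset hm Set.Ico_subset_Iio_self, ENNReal.toReal_one]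
    have h2 : m.real (Set.Iio 0) = 0 := by
      rw [measureReal_def, measure_eq_zero_of_disjoint_Ico hm, ENNReal.toReal_zero]
      exact Set.disjoint_left.2 fun x hx hx' => not_lt.2 hx'.1 hx
    simp [quasiCdf, h1, h2]
  · have : ⌈x⌉ = 1 := by
      rw [Int.ceil_eq_iff]
      norm_num
      exact ⟨h0, hx.2⟩
    simp [quasiCdf, this]

theorem quasiCdf_zero (hm : m (Set.Ico 0 1)ᶜ = 0) : quasiCdf m 0 = 0 := by
  rw [quasiCdf_eq hm (by simp), measureReal_def, measure_eq_zero_of_disjoint_Ico hm,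
    ENNReal.toReal_zero]
  exact Set.disjoint_left.2 fun x hx hx' => not_lt.2 hx'.1 hx

theorem quasiCdf_add_one (m : Measure ℝ) (x : ℝ) : quasiCdf m (x + 1) = quasiCdf m x + 1 := by
  simp only [quasiCdf, Int.ceil_add_one, Int.cast_add, Int.cast_one]
  rw [add_sub_add_right_eq_sub]
  ring

theorem quasiCdf_monotone : Monotone (quasiCdf m) := by
  intro x x' hx
  rcases (Int.ceil_mono hx).eq_or_lt with h | h
  · rw [quasiCdf, quasiCdf, h]
    gcongr
    exact measure_ne_top _ _
  · have h1 : m.real (Set.Iio (x - ⌈x⌉ + 1)) ≤ 1 := measureReal_le_one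
    have h2 : 0 ≤ m.real (Set.Iio (x' - ⌈x'⌉ + 1)) := measureReal_nonneg
    have h3 : (⌈x⌉ : ℝ) + 1 ≤ ⌈x'⌉ := by exact_mod_cast h
    rw [quasiCdf, quasiCdf]
    linarith

/-- Left continuity, from continuity of `m` from below along the sets `Iio`. The ceiling puts `x -
⌈x⌉ + 1` in `(0, 1]`, so it can be approached from the left without a change of `⌈x⌉`, even at
integers and with no assumption on the support of `m`. -/
theorem exists_lt_quasiCdf {u x : ℝ} (h : u < quasiCdf m x) : ∃ x' < x, u < quasiCdf m x' := by
  set c : ℝ := ⌈x⌉ - 1 with hc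
  set a : ℝ := x - ⌈x⌉ + 1 with ha
  have ha0 : 0 < a := by
    have := Int.ceil_lt_add_one x
    linarith
  obtain ⟨t, htm, hta, htlim⟩ := exists_seq_strictMono_tendsto' ha0
  have hU : Set.Iio a = ⋃ n, Set.Iio (t n) := by
    ext z
    simp only [Set.mem_Iio, Set.mem_iUnion]
    constructor
    · exact fun hz => (htlim.eventually_const_lt hz).exists
    · rintro ⟨n, hn⟩
      exact hn.trans (hta n).2
  have hlim : Filter.Tendsto (fun n => m.real (Set.Iio (t n))) Filter.atTop
      (nhds (m.real (Set.Iio a))) := by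
    rw [hU]
    refine (ENNReal.tendsto_toReal (measure_ne_top _ _)).comp ?_
    exact tendsto_measure_iUnion_atTop fun i j hij => Set.Iio_subset_Iio (htm.monotone hij)
  have h' : u - c < m.real (Set.Iio a) := by
    have : u < c + m.real (Set.Iio a) := h
    linarith
  obtain ⟨n, hn⟩ := (hlim.eventually_const_lt h').exists
  refine ⟨t n + c, by linarith [(hta n).2], ?_⟩
  have hceil : ⌈t n + c⌉ = ⌈x⌉ := by
    rw [Int.ceil_eq_iff]
    have := Int.le_ceil x
    constructor <;> linarith [(hta n).1, (hta n).2]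
  rw [quasiCdf, hceil, show t n + c - ⌈x⌉ + 1 = t n by rw [hc]; ring]
  linarith

theorem abs_quasiCdf_sub_le (x : ℝ) : |quasiCdf m x - x| ≤ 1 := by
  have h1 : m.real (Set.Iio (x - ⌈x⌉ + 1)) ≤ 1 := measureReal_le_one
  have h2 : 0 ≤ m.real (Set.Iio (x - ⌈x⌉ + 1)) := measureReal_nonneg
  have h3 := Int.le_ceil x
  have h4 := Int.ceil_lt_add_one x
  rw [abs_le, quasiCdf]
  constructor <;> linarith

/-- The bound `|Φ x - x| ≤ 1` makes the sublevel sets nonempty and bounded above. Monotonicity and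
left continuity make them closed half-lines, hence `T u < x` exactly when `x` lies outside. -/
theorem inversePair_quasiCdf : InversePair (quasiCdf m) (quasiQuantile m) where
  add_one := quasiCdf_add_one m
  lt_iff u x := by
    have hbdd : BddAbove {x | quasiCdf m x ≤ u} := by
      refine ⟨u + 1, fun z hz => ?_⟩
      have h1 := (abs_le.1 (abs_quasiCdf_sub_le (m := m) z)).1
      have h2 : quasiCdf m z ≤ u := hz
      linarith
    have hne : {x | quasiCdf m x ≤ u}.Nonempty := by
      refine ⟨u - 1, ?_⟩
      have h1 := (abs_le.1 (abs_quasiCdf_sub_le (m := m) (u - 1))).2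
      change quasiCdf m (u - 1) ≤ u
      linarith
    constructor
    · intro h
      by_contra! hle
      exact absurd (le_csSup hbdd hle) (not_le.2 h)
    · intro h
      obtain ⟨x', hx', hlt⟩ := exists_lt_quasiCdf h
      refine lt_of_le_of_lt (csSup_le hne fun z hz => ?_) hx'
      by_contra! hle
      exact absurd (hlt.trans_le (quasiCdf_monotone hle.le)) (not_lt.2 hz)

theorem quasiQuantile_mem_Ico (hm : m (Set.Ico 0 1)ᶜ = 0) {u : ℝ} (hu : u ∈ Set.Ico (0 : ℝ) 1) :
    quasiQuantile m u ∈ Set.Ico (0 : ℝ) 1 := by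
  have h0 := quasiCdf_zero hm
  have h1 := quasiCdf_add_one m 0
  rw [zero_add, h0, zero_add] at h1
  constructor
  · rw [← not_lt, inversePair_quasiCdf.lt_iff, h0, not_lt]
    exact hu.1
  · rw [inversePair_quasiCdf.lt_iff, h1]
    exact hu.2

/-- It suffices to compare the half-lines `Ici x`. Their preimages are the half-lines `Ici (Φ x)`,
which meet `[0, 1)` in length `1 - Φ x = m (Ici x)` for `x` in `[0, 1]`. -/
theorem map_quasiQuantile (hm : m (Set.Ico 0 1)ᶜ = 0) :
    (volume.restrict (Set.Ico (0 : ℝ) 1)).map (quasiQuantile m) = m := by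
  have hT : Measurable (quasiQuantile m) := inversePair_quasiCdf.monotone_right.measurable
  have h0 := quasiCdf_zero hm
  have h1 := quasiCdf_add_one m 0
  rw [zero_add, h0, zero_add] at h1
  refine Measure.ext_of_Ici _ _ fun x => ?_
  have hpre : quasiQuantile m ⁻¹' Set.Ici x = Set.Ici (quasiCdf m x) := by
    ext u
    simp only [Set.mem_preimage, Set.mem_Ici]
    rw [← not_lt, inversePair_quasiCdf.lt_iff, not_lt]
  rw [Measure.map_apply hT measurableSet_Ici, hpre, Measure.restrict_apply measurableSet_Ici]
  rcases le_total x 0 with hx | hx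
  · have hΦ := quasiCdf_monotone (m := m) hx
    rw [h0] at hΦ
    rw [Set.inter_eq_self_of_subset_right (Set.Ico_subset_Icc_self.trans
        (Set.Icc_subset_Ici_self.trans (Set.Ici_subset_Ici.2 hΦ))),
      measure_eq_one_of_Ico_subset hm (Set.Ico_subset_Icc_self.trans
        (Set.Icc_subset_Ici_self.trans (Set.Ici_subset_Ici.2 hx)))]
    simp
  rcases le_total x 1 with hx1 | hx1
  · have hΦ0 := quasiCdf_monotone (m := m) hx
    rw [h0] at hΦ0
    have : Set.Ici (quasiCdf m x) ∩ Set.Ico 0 1 = Set.Ico (quasiCdf m x) 1 := by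
      ext z
      simp only [Set.mem_inter_iff, Set.mem_Ici, Set.mem_Ico]
      exact ⟨fun h => ⟨h.1, h.2.2⟩, fun h => ⟨h.1, hΦ0.trans h.1, h.2⟩⟩
    rw [this, Real.volume_Ico, quasiCdf_eq hm ⟨hx, hx1⟩, ← Set.compl_Iio,
      prob_compl_eq_one_sub measurableSet_Iio, ENNReal.ofReal_sub _ measureReal_nonneg,
      ofReal_measureReal, ENNReal.ofReal_one]
  · have hΦ := quasiCdf_monotone (m := m) hx1
    rw [h1] at hΦ
    have : Set.Ici (quasiCdf m x) ∩ Set.Ico 0 1 = ∅ := by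
      ext z
      simp only [Set.mem_inter_iff, Set.mem_Ici, Set.mem_Ico, Set.mem_empty_iff_false, iff_false]
      intro h
      linarith [h.1, h.2.2]
    rw [this, measure_empty, measure_eq_zero_of_disjoint_Ico hm]
    exact Set.disjoint_left.2 fun z hz hz' => not_lt.2 (hx1.trans hz) hz'.2

end

/-! ### Passage to the endpoint exponents -/

theorem continuousAt_rpow_exponent {a : ℝ≥0∞} (h0 : a ≠ 0) (htop : a ≠ ⊤) (t : ℝ) :
    ContinuousAt (fun t : ℝ => a ^ t) t := by
  lift a to NNReal using htop
  have ha : a ≠ 0 := by exact_mod_cast h0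
  have ha' : (a : ℝ) ≠ 0 := by exact_mod_cast ha
  have h1 : (fun t : ℝ => (a : ℝ≥0∞) ^ t) = fun t : ℝ => ENNReal.ofReal ((a : ℝ) ^ t) := by
    ext1 t
    rw [← ENNReal.ofReal_rpow_of_pos (by positivity), ENNReal.ofReal_coe_nnreal]
  rw [h1]
  exact (ENNReal.continuous_ofReal.continuousAt).comp (Real.continuousAt_const_rpow ha')

/-- If `|f| ≥ ε > c` on a set of measure `δ > 0`, Chebyshev gives `ε * δ ^ (1 / n) ≤ c`, and `δ ^ (1
/ n) → 1` is a contradiction. -/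
theorem eLpNorm_top_le_of_forall_eLpNorm_le {Ω : Type*} [MeasurableSpace Ω] {P : Measure Ω}
    [IsFiniteMeasure P] {f : Ω → ℝ} (hf : AEStronglyMeasurable f P) {c : ℝ≥0∞}
    (h : ∀ n : ℕ, 2 ≤ n → eLpNorm f n P ≤ c) : eLpNorm f ⊤ P ≤ c := by
  rw [eLpNorm_exponent_top]
  refine le_of_forall_gt_imp_ge_of_dense fun ε hε => ?_
  refine eLpNormEssSup_le_of_ae_enorm_bound ?_
  rw [ae_iff]
  by_contra h0
  have hpos : P {x | ε ≤ ‖f x‖ₑ} ≠ 0 := by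
    intro h1
    refine h0 (measure_mono_null (fun x hx => ?_) h1)
    exact (not_le.1 hx).le
  set δ := P {x | ε ≤ ‖f x‖ₑ} with hδ
  have hbound : ∀ n : ℕ, 2 ≤ n → ε * δ ^ ((n : ℝ)⁻¹) ≤ c := by
    intro n hn
    have hn0 : (n : ℝ≥0∞) ≠ 0 := by exact_mod_cast (by omega : n ≠ 0)
    have := mul_meas_ge_le_pow_eLpNorm' P hn0 (ENNReal.natCast_ne_top n) hf ε
    have h2 := this.trans (ENNReal.rpow_le_rpow (h n hn) (by positivity))
    have hn' : 0 < (n : ℝ) := by exact_mod_cast (by omega : 0 < n)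
    rw [ENNReal.toReal_natCast] at h2
    have h3 := ENNReal.rpow_le_rpow h2 (inv_nonneg.2 hn'.le)
    rwa [ENNReal.mul_rpow_of_nonneg _ _ (inv_nonneg.2 hn'.le), ← ENNReal.rpow_mul,
      ← ENNReal.rpow_mul, mul_inv_cancel₀ hn'.ne', ENNReal.rpow_one, ENNReal.rpow_one] at h3
  have hlim : Filter.Tendsto (fun n : ℕ => ε * δ ^ ((n : ℝ)⁻¹)) Filter.atTop (nhds (ε * 1)) := by
    refine ENNReal.Tendsto.const_mul ?_ (Or.inl one_ne_zero)
    have h1 := (continuousAt_rpow_exponent hpos (measure_ne_top _ _) 0).tendsto.comp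
      (tendsto_inv_atTop_nhds_zero_nat (𝕜 := ℝ))
    simpa [Function.comp_def] using h1
  rw [mul_one] at hlim
  refine absurd (le_of_tendsto hlim ?_) (not_le.2 hε)
  filter_upwards [Filter.eventually_ge_atTop 2] with n hn using hbound n hn

/-- Extension of a family of lower bounds from the exponents in `(1, ⊤)` to the endpoints. -/
theorem iInf_eLpNorm_sub_le {Ω : Type*} [MeasurableSpace Ω] {P : Measure Ω}
    [IsProbabilityMeasure P] {f : Ω → ℝ} (hf : AEStronglyMeasurable f P) {C : ℝ}
    (hfC : ∀ x, |f x| ≤ C) {Y : Set ℝ} (hY : IsCompact Y) {A : ℝ≥0∞ → ℝ≥0∞} {B : ℝ≥0∞}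
    (hB0 : B ≠ 0) (hB : B ≠ ⊤) (hA : ∀ p, 1 ≤ p → A p ≤ A ⊤)
    (h : ∀ r : ℝ, 1 < r → ∃ y ∈ Y, eLpNorm (fun x => f x - y) (ENNReal.ofReal r) P ≤
      A (ENNReal.ofReal r) ∧
      eLpNorm (fun x => f x - y) (ENNReal.ofReal r) P ^ r ≤ B ^ (r - 1) * A 1)
    {p : ℝ≥0∞} (hp : 1 ≤ p) : ⨅ y ∈ Y, eLpNorm (fun x => f x - y) p P ≤ A p := by
  have hm : ∀ y : ℝ, AEStronglyMeasurable (fun x => f x - y) P :=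
    fun y => hf.sub aestronglyMeasurable_const
  rcases eq_or_ne p ⊤ with rfl | hptop
  -- The shifts for the exponents `n + 2` accumulate at some `z` in `Y`. For fixed `k` the `k`-norm
  -- is at most the later norms, and replacing `y (φ n)` by `z` costs only `|y (φ n) - z|`.
  · have h' : ∀ n : ℕ, ∃ y ∈ Y, eLpNorm (fun x => f x - y) ((n + 2 : ℕ) : ℝ≥0∞) P ≤ A ⊤ := by
      intro n
      have h1 : (1 : ℝ) < (n + 2 : ℕ) := by
        push_cast
        linarith [n.cast_nonneg (α := ℝ)]
      obtain ⟨y, hy, hle, -⟩ := h _ h1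
      rw [ENNReal.ofReal_natCast] at hle
      refine ⟨y, hy, hle.trans (hA _ ?_)⟩
      exact_mod_cast (by omega : 1 ≤ n + 2)
    choose y hyY hy using h'
    obtain ⟨z, hz, φ, hφ, hlim⟩ := hY.tendsto_subseq hyY
    refine (iInf₂_le z hz).trans ?_
    refine eLpNorm_top_le_of_forall_eLpNorm_le (hm z) fun k hk => ?_
    have hk1 : (1 : ℝ≥0∞) ≤ k := by exact_mod_cast (by omega : 1 ≤ k)
    have hbound : ∀ n ≥ k, eLpNorm (fun x => f x - z) k P ≤
        A ⊤ + ENNReal.ofReal |y (φ n) - z| := by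
      intro n hn
      have h1 : (fun x => f x - z) = (fun x => f x - y (φ n)) + fun _ => y (φ n) - z := by
        ext x
        simp
      rw [h1]
      refine (eLpNorm_add_le (hm _) aestronglyMeasurable_const hk1).trans (add_le_add ?_ ?_)
      · refine (eLpNorm_le_eLpNorm_of_exponent_le ?_ (hm _)).trans (hy (φ n))
        have := hφ.le_apply (x := n)
        exact_mod_cast (by omega : k ≤ φ n + 2)
      · rw [eLpNorm_const _ (by positivity) (IsProbabilityMeasure.ne_zero P)]
        simp [Real.enorm_eq_ofReal_abs]
    have hlim' : Filter.Tendsto (fun n => A ⊤ + ENNReal.ofReal |y (φ n) - z|) Filter.atTop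
        (nhds (A ⊤ + ENNReal.ofReal |z - z|)) := by
      refine Filter.Tendsto.const_add _ (ENNReal.tendsto_ofReal ?_)
      exact (hlim.sub_const z).abs
    simp only [sub_self, abs_zero, ENNReal.ofReal_zero, add_zero] at hlim'
    refine ge_of_tendsto hlim' ?_
    filter_upwards [Filter.eventually_ge_atTop k] with n hn using hbound n hn
  rcases hp.eq_or_lt with rfl | hp1
  · set M := ⨅ y ∈ Y, eLpNorm (fun x => f x - y) 1 P with hM
    -- The limit `r ↓ 1` below uses continuity of `M ^ r` in `r`, hence needs `M` positive and
    -- finite.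
    rcases eq_or_ne M 0 with hM0 | hM0
    · rw [hM0]
      exact zero_le
    have hMtop : M ≠ ⊤ := by
      obtain ⟨y, hy, -⟩ := h 2 one_lt_two
      refine ne_top_of_le_ne_top ?_ (iInf₂_le y hy)
      refine (MemLp.of_bound (hm y) (C + |y|) (Filter.Eventually.of_forall fun x => ?_)).2.ne
      exact (norm_sub_le _ _).trans (add_le_add_left (hfC x) _)
    have hle : ∀ r : ℝ, 1 < r → M ^ r ≤ B ^ (r - 1) * A 1 := by
      intro r hr
      obtain ⟨y, hy, -, hle⟩ := h r hr
      refine (ENNReal.rpow_le_rpow ?_ (by linarith)).trans hle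
      refine (iInf₂_le y hy).trans (eLpNorm_le_eLpNorm_of_exponent_le ?_ (hm y))
      rw [← ENNReal.ofReal_one]
      exact ENNReal.ofReal_le_ofReal hr.le
    have l1 : Filter.Tendsto (fun r : ℝ => M ^ r) (nhdsWithin 1 (Set.Ioi 1)) (nhds (M ^ (1 : ℝ))) :=
      (continuousAt_rpow_exponent hM0 hMtop 1).tendsto.mono_left nhdsWithin_le_nhds
    have l2 : Filter.Tendsto (fun r : ℝ => B ^ (r - 1) * A 1) (nhdsWithin 1 (Set.Ioi 1))
        (nhds (B ^ (1 - 1 : ℝ) * A 1)) := by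
      refine ENNReal.Tendsto.mul_const ?_ (Or.inl (by simp))
      refine Filter.Tendsto.mono_left ?_ nhdsWithin_le_nhds
      exact (continuousAt_rpow_exponent hB0 hB (1 - 1)).tendsto.comp
        ((continuous_id.sub continuous_const).tendsto' _ _ rfl)
    have := le_of_tendsto_of_tendsto l1 l2 (eventually_nhdsWithin_of_forall fun r hr => hle r hr)
    simpa using this
  · have hr : 1 < p.toReal := by
      rw [← ENNReal.toReal_one]
      exact (ENNReal.toReal_lt_toReal ENNReal.one_ne_top hptop).2 hp1
    obtain ⟨y, hy, hle, -⟩ := h _ hr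
    rw [ENNReal.ofReal_toReal hptop] at hle
    exact (iInf₂_le y hy).trans hle

/-! ### General bounds on Wasserstein distances -/

section Wasserstein

variable {X : Type*} [PseudoMetricSpace X] [SecondCountableTopology X] [MeasurableSpace X]
  [BorelSpace X] {μ ν : Measure X}

theorem wasserstein_mono [IsProbabilityMeasure μ] {p q : ℝ≥0∞} (hpq : p ≤ q) :
    wasserstein p μ ν ≤ wasserstein q μ ν := by
  refine iInf₂_mono fun π hπ => ?_
  have : IsProbabilityMeasure π := by
    constructor
    rw [← Set.preimage_univ (f := Prod.fst), ← Measure.map_apply measurable_fst .univ, hπ.1,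
      measure_univ]
  exact eLpNorm_le_eLpNorm_of_exponent_le hpq continuous_dist.aestronglyMeasurable

/-- The coupling is the image of `ν` under `u ↦ (τ u, u)`. -/
theorem wasserstein_le_of_measurePreserving {τ : X → X} (hτ : MeasurePreserving τ ν μ)
    (p : ℝ≥0∞) : wasserstein p μ ν ≤ eLpNorm (fun u => dist (τ u) u) p ν := by
  have hm : Measurable fun u => (τ u, u) := hτ.measurable.prodMk measurable_id
  refine (iInf₂_le (ν.map fun u => (τ u, u)) ?_).trans ?_
  · refine ⟨?_, ?_⟩
    · rw [Measure.map_map measurable_fst hm]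
      exact hτ.map_eq
    · rw [Measure.map_map measurable_snd hm]
      exact Measure.map_id
  · rw [eLpNorm_map_measure continuous_dist.aestronglyMeasurable hm.aemeasurable]
    rfl

/-- Lower bounds on Wasserstein distances from a dual pair of potentials. -/
theorem le_wasserstein_of_potential [IsProbabilityMeasure μ] [IsProbabilityMeasure ν]
    (hdist : ∀ x y : X, dist x y ≤ 1) {τ : X → X} (hτ : MeasurePreserving τ ν μ) {φ e : X → ℝ}
    (hφ : Integrable φ μ) (he : Integrable e ν) {r : ℝ} (hr : 1 < r)
    (hle : ∀ x u, φ x + (e u - φ (τ u)) ≤ dist x u ^ r) :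
    ENNReal.ofReal (∫ u, e u ∂ν) ≤ wasserstein (ENNReal.ofReal r) μ ν ^ r ∧
      ENNReal.ofReal (∫ u, e u ∂ν) ≤ wasserstein 1 μ ν := by
  have hr0 : 0 < r := by linarith
  have key : ∀ π : Measure (X × X), IsCoupling π μ ν →
      ENNReal.ofReal (∫ u, e u ∂ν) ≤ ∫⁻ z, ENNReal.ofReal (dist z.1 z.2 ^ r) ∂π := by
    intro π hπ
    have : IsProbabilityMeasure π := by
      constructor
      rw [← Set.preimage_univ (f := Prod.fst), ← Measure.map_apply measurable_fst .univ, hπ.1,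
        measure_univ]
    have hc : Integrable (fun z : X × X => dist z.1 z.2 ^ r) π := by
      refine Integrable.of_bound (C := 1)
        (continuous_dist.rpow_const fun _ => Or.inr hr0.le).aestronglyMeasurable
        (Filter.Eventually.of_forall fun z => ?_)
      rw [Real.norm_of_nonneg (by positivity)]
      exact Real.rpow_le_one dist_nonneg (hdist _ _) hr0.le
    rw [← ofReal_integral_eq_lintegral_ofReal hc
      (Filter.Eventually.of_forall fun z => by positivity)]
    exact ENNReal.ofReal_le_ofReal (integral_le_integral_of_isCoupling hπ hτ hφ he hc hle)
  constructor
  · rw [← ENNReal.rpow_inv_le_iff hr0]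
    refine le_iInf₂ fun π hπ => ?_
    rw [ENNReal.rpow_inv_le_iff hr0]
    refine (key π hπ).trans (le_of_eq ?_)
    rw [eLpNorm_eq_lintegral_rpow_enorm_toReal (by simpa using hr0) ENNReal.ofReal_ne_top,
      ENNReal.toReal_ofReal hr0.le, ← ENNReal.rpow_mul, one_div, inv_mul_cancel₀ hr0.ne',
      ENNReal.rpow_one]
    refine lintegral_congr fun z => ?_
    rw [Real.enorm_of_nonneg dist_nonneg, ENNReal.ofReal_rpow_of_nonneg dist_nonneg hr0.le]
  -- Distances are at most `1`, so `dist ^ r ≤ dist`: the potential for the exponent `r` also bounds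
  -- `W_1`.
  · refine le_iInf₂ fun π hπ => (key π hπ).trans ?_
    rw [eLpNorm_one_eq_lintegral_enorm]
    refine lintegral_mono fun z => ?_
    rw [Real.enorm_of_nonneg dist_nonneg]
    refine ENNReal.ofReal_le_ofReal ?_
    exact Real.rpow_le_self_of_le_one dist_nonneg (hdist _ _) hr.le

end Wasserstein

/-! ### Primitives, integration by parts and weak derivatives -/

/-- Fubini's theorem for the primitive of `g`. -/
theorem integral_mul_primitive {m : Measure ℝ} [SFinite m] (hm : m (Set.Ico 0 1)ᶜ = 0) {w g : ℝ → ℝ}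
    (hw : Integrable w m) (hg : IntegrableOn g (Set.Ioc 0 1)) :
    Integrable (fun x => w x * ∫ t in (0 : ℝ)..x, g t) m ∧
    ∫ x, (w x * ∫ t in (0 : ℝ)..x, g t) ∂m =
      ∫ t in (0 : ℝ)..1, (∫ x in Set.Ici t, w x ∂m) * g t := by
  have hS : MeasurableSet {z : ℝ × ℝ | z.2 ≤ z.1} := measurableSet_le measurable_snd measurable_fst
  have hint : Integrable (Set.indicator {z : ℝ × ℝ | z.2 ≤ z.1} fun z => w z.1 * g z.2)
      (m.prod (volume.restrict (Set.Ioc 0 1))) := (hw.mul_prod hg).indicator hS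
  have hae : ∀ᵐ x ∂m, x ∈ Set.Ico (0 : ℝ) 1 := hm
  have hpt : (fun x => w x * ∫ t in (0 : ℝ)..x, g t) =ᵐ[m] fun x => ∫ t in Set.Ioc (0 : ℝ) 1,
      Set.indicator {z : ℝ × ℝ | z.2 ≤ z.1} (fun z => w z.1 * g z.2) (x, t) := by
    filter_upwards [hae] with x hx
    rw [← intervalIntegral.integral_const_mul, intervalIntegral.integral_of_le hx.1]
    have : ∀ t, Set.indicator {z : ℝ × ℝ | z.2 ≤ z.1} (fun z => w z.1 * g z.2) (x, t) =
        (Set.Iic x).indicator (fun t => w x * g t) t := fun t => rfl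
    simp only [this]
    rw [integral_indicator measurableSet_Iic, Measure.restrict_restrict measurableSet_Iic,
      Set.inter_comm, Set.Ioc_inter_Iic, min_eq_right hx.2.le]
  refine ⟨(integrable_congr hpt).2 hint.integral_prod_left, ?_⟩
  rw [integral_congr_ae hpt]
  refine (integral_integral_swap (f := fun x t =>
    Set.indicator {z : ℝ × ℝ | z.2 ≤ z.1} (fun z => w z.1 * g z.2) (x, t)) hint).trans ?_
  rw [intervalIntegral.integral_of_le zero_le_one]
  refine integral_congr_ae (Filter.Eventually.of_forall fun t => ?_)
  have : ∀ x, Set.indicator {z : ℝ × ℝ | z.2 ≤ z.1} (fun z => w z.1 * g z.2) (x, t) =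
      (Set.Ici t).indicator (fun x => w x * g t) x := fun x => rfl
  simp only [this]
  rw [integral_indicator measurableSet_Ici, integral_mul_const]

instance isProbabilityMeasure_restrict_Ico :
    IsProbabilityMeasure (volume.restrict (Set.Ico (0 : ℝ) 1)) := ⟨by simp⟩

theorem restrict_Ico_compl : volume.restrict (Set.Ico (0 : ℝ) 1) (Set.Ico 0 1)ᶜ = 0 := by
  rw [Measure.restrict_apply measurableSet_Ico.compl, Set.compl_inter_self, measure_empty]

theorem measurable_quasiCdf (m : Measure ℝ) [IsProbabilityMeasure m] : Measurable (quasiCdf m) :=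
  quasiCdf_monotone.measurable

theorem integrableOn_quasiCdf_sub_mul (m : Measure ℝ) [IsProbabilityMeasure m] {g : ℝ → ℝ}
    {s : Set ℝ} (hg : IntegrableOn g s) :
    IntegrableOn (fun t => (quasiCdf m t - t) * g t) s := by
  refine hg.bdd_mul (c := 1) ((measurable_quasiCdf m).sub measurable_id).aestronglyMeasurable
    (Filter.Eventually.of_forall fun t => ?_)
  exact abs_quasiCdf_sub_le t

/-- The pairing of `μ - λ` with a primitive of `g`. -/
theorem integral_sub_integral_primitive {m : Measure ℝ} [IsProbabilityMeasure m]
    (hm : m (Set.Ico 0 1)ᶜ = 0) {f g : ℝ → ℝ} (hg : IntegrableOn g (Set.Ioc 0 1))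
    (hf : ∀ x ∈ Set.Ico (0 : ℝ) 1, f x = f 0 + ∫ t in (0 : ℝ)..x, g t) :
    ∫ x, f x ∂m - ∫ x in Set.Ico (0 : ℝ) 1, f x =
      -∫ t in (0 : ℝ)..1, (quasiCdf m t - t) * g t := by
  -- Applied to both `m` and Lebesgue measure: the constants `f 0` cancel, and the tails `ν (Ici t)`
  -- differ by `t - quasiCdf m t`.
  have key : ∀ (ν : Measure ℝ) [IsProbabilityMeasure ν], ν (Set.Ico 0 1)ᶜ = 0 →
      ∫ x, f x ∂ν = f 0 + ∫ t in (0 : ℝ)..1, ν.real (Set.Ici t) * g t := by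
    intro ν _ hν
    obtain ⟨h0, h1⟩ := integral_mul_primitive hν (integrable_const (1 : ℝ)) hg
    simp only [one_mul, integral_const, MeasurableSet.univ, measureReal_restrict_apply,
      Set.univ_inter, smul_eq_mul, mul_one] at h0 h1
    have hae : ∀ᵐ x ∂ν, x ∈ Set.Ico (0 : ℝ) 1 := hν
    rw [← h1, ← integral_congr_ae (hae.mono fun x hx => (hf x hx).symm),
      integral_add (integrable_const _) h0]
    simp
  have hgm : ∀ (ν : Measure ℝ) [IsProbabilityMeasure ν],
      IntervalIntegrable (fun t => ν.real (Set.Ici t) * g t) volume 0 1 := by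
    intro ν _
    rw [intervalIntegrable_iff_integrableOn_Ioc_of_le zero_le_one]
    refine hg.bdd_mul (c := 1) ?_ (Filter.Eventually.of_forall fun t => ?_)
    · have : Antitone fun t => ν.real (Set.Ici t) := fun s t hst =>
        measureReal_mono (Set.Ici_subset_Ici.2 hst)
      exact this.measurable.aestronglyMeasurable
    · rw [Real.norm_of_nonneg measureReal_nonneg]
      exact measureReal_le_one
  rw [key m hm, key _ restrict_Ico_compl, add_sub_add_left_eq_sub,
    ← intervalIntegral.integral_sub (hgm m) (hgm _), ← intervalIntegral.integral_neg]
  refine intervalIntegral.integral_congr fun t ht => ?_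
  rw [Set.uIcc_of_le zero_le_one] at ht
  have h1 : (volume.restrict (Set.Ico (0 : ℝ) 1)).real (Set.Ici t) = 1 - t := by
    have : Set.Ici t ∩ Set.Ico 0 1 = Set.Ico t 1 := by
      ext z
      simp only [Set.mem_inter_iff, Set.mem_Ici, Set.mem_Ico]
      exact ⟨fun h => ⟨h.1, h.2.2⟩, fun h => ⟨h.1, ht.1.trans h.1, h.2⟩⟩
    rw [measureReal_restrict_apply measurableSet_Ici, this, Real.volume_real_Ico_of_le ht.2]
  have h2 : m.real (Set.Ici t) = 1 - quasiCdf m t := by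
    rw [quasiCdf_eq hm ht, ← Set.compl_Iio, probReal_compl_eq_one_sub measurableSet_Iio]
  simp only [h1, h2]
  ring

/-- Integration by parts for the primitive of an integrable function. -/
theorem integral_primitive_mul_deriv {g φ φ' : ℝ → ℝ} (hg : IntegrableOn g (Set.Ioc 0 1))
    (hφ : ∀ x, HasDerivAt φ (φ' x) x) (hφ' : Continuous φ') :
    ∫ x in Set.Ico (0 : ℝ) 1, (∫ t in (0 : ℝ)..x, g t) * φ' x =
      φ 1 * (∫ t in (0 : ℝ)..1, g t) - ∫ t in (0 : ℝ)..1, g t * φ t := by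
  have hint : IntegrableOn φ' (Set.Ico 0 1) :=
    (hφ'.integrableOn_Icc).mono_set Set.Ico_subset_Icc_self
  have hcφ : Continuous φ := continuous_iff_continuousAt.2 fun x => (hφ x).continuousAt
  -- Fubini with weight `φ'`; its tail integral from `t` to `1` is `φ 1 - φ t`.
  obtain ⟨-, h1⟩ := integral_mul_primitive restrict_Ico_compl hint hg
  simp only [mul_comm _ (φ' _)]
  have hgi : IntervalIntegrable g volume 0 1 :=
    (intervalIntegrable_iff_integrableOn_Ioc_of_le zero_le_one).2 hg
  rw [h1, ← intervalIntegral.integral_const_mul, ← intervalIntegral.integral_sub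
    (hgi.const_mul _) (hgi.mul_continuousOn hcφ.continuousOn)]
  refine intervalIntegral.integral_congr fun t ht => ?_
  rw [Set.uIcc_of_le zero_le_one] at ht
  have : Set.Ici t ∩ Set.Ico 0 1 = Set.Ico t 1 := by
    ext z
    simp only [Set.mem_inter_iff, Set.mem_Ici, Set.mem_Ico]
    exact ⟨fun h => ⟨h.1, h.2.2⟩, fun h => ⟨h.1, ht.1.trans h.1, h.2⟩⟩
  rw [Measure.restrict_restrict measurableSet_Ici, this, integral_Ico_eq_integral_Ioc,
    ← intervalIntegral.integral_of_le ht.2,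
    intervalIntegral.integral_eq_sub_of_hasDerivAt (fun x _ => hφ x)
      (hφ'.intervalIntegrable _ _)]
  ring

theorem LocallyIntegrableOn.integrable_mul_of_tsupport_subset {w ψ : ℝ → ℝ} {U : Set ℝ}
    (hw : LocallyIntegrableOn w U) (hψ : Continuous ψ) (hc : HasCompactSupport ψ)
    (hs : tsupport ψ ⊆ U) : Integrable fun x => w x * ψ x := by
  have h1 : IntegrableOn w (tsupport ψ) := hw.integrableOn_compact_subset hs hc
  refine (integrableOn_iff_integrable_of_support_subset (s := tsupport ψ) ?_).1
    (h1.mul_continuousOn hψ.continuousOn hc)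
  exact fun x hx => subset_tsupport ψ fun h => hx (by simp [h])

/-- The du Bois-Reymond lemma on `(0, 1)`. -/
theorem ae_eq_const_of_forall_integral_mul_deriv_eq_zero {w : ℝ → ℝ}
    (hw : LocallyIntegrableOn w (Set.Ioo 0 1))
    (h : ∀ φ : ℝ → ℝ, ContDiff ℝ ∞ φ → HasCompactSupport φ → tsupport φ ⊆ Set.Ioo 0 1 →
      ∫ x, w x * deriv φ x = 0) :
    ∃ c : ℝ, ∀ᵐ x, x ∈ Set.Ioo (0 : ℝ) 1 → w x = c := by
  let b : ContDiffBump (1 / 2 : ℝ) := ⟨1 / 8, 1 / 4, by norm_num, by norm_num⟩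
  set η : ℝ → ℝ := b.normed volume
  have hη : ContDiff ℝ ∞ η := b.contDiff_normed
  have hη1 : ∫ x, η x = 1 := b.integral_normed
  have hηs : tsupport η = Set.Icc (1 / 4) (3 / 4) := by
    rw [b.tsupport_normed_eq, Real.closedBall_eq_Icc]
    norm_num
  have hηc : HasCompactSupport η := by
    rw [HasCompactSupport, hηs]
    exact isCompact_Icc
  have hηU : tsupport η ⊆ Set.Ioo 0 1 := by
    rw [hηs]
    intro x hx
    constructor <;> linarith [hx.1, hx.2]
  refine ⟨∫ x, w x * η x, ?_⟩
  set c := ∫ x, w x * η x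
  have hwc : LocallyIntegrableOn (fun x => w x - c) (Set.Ioo 0 1) :=
    hw.sub (continuous_const.locallyIntegrable.locallyIntegrableOn _)
  have := isOpen_Ioo.ae_eq_zero_of_integral_contDiff_smul_eq_zero hwc ?_
  · filter_upwards [this] with x hx hx' using sub_eq_zero.1 (hx hx')
  intro ψ hψ hψc hψU
  set a := ∫ x, ψ x
  -- Subtracting `a * η` makes the integral zero, so the primitive of `ρ` vanishes outside a compact
  -- subset of `(0, 1)` and is an admissible test function.
  let ρ : ℝ → ℝ := fun x => ψ x - a * η x
  have hρ : ContDiff ℝ ∞ ρ := hψ.sub (contDiff_const.mul hη)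
  have hψi := hψ.continuous.integrable_of_hasCompactSupport (μ := volume) hψc
  have hηi := hη.continuous.integrable_of_hasCompactSupport (μ := volume) hηc
  have hρ0 : ∫ x, ρ x = 0 := by
    rw [integral_sub hψi (hηi.const_mul a), integral_const_mul, hη1]
    simp [a]
  obtain ⟨α, β, hα, hβ, hK⟩ : ∃ α β : ℝ, 0 < α ∧ β < 1 ∧ ∀ x, ρ x ≠ 0 → x ∈ Set.Icc α β := by
    have hcomp : IsCompact (tsupport ψ ∪ tsupport η) := hψc.isCompact.union hηc.isCompact
    have hne : (tsupport ψ ∪ tsupport η).Nonempty := ⟨1 / 2, Or.inr (by rw [hηs]; norm_num)⟩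
    obtain ⟨α, hαm, hα⟩ := hcomp.exists_isLeast hne
    obtain ⟨β, hβm, hβ⟩ := hcomp.exists_isGreatest hne
    have hU : tsupport ψ ∪ tsupport η ⊆ Set.Ioo 0 1 := Set.union_subset hψU hηU
    refine ⟨α, β, (hU hαm).1, (hU hβm).2, fun x hx => ?_⟩
    have : x ∈ tsupport ψ ∪ tsupport η := by
      by_contra hn
      rw [Set.mem_union, not_or] at hn
      apply hx
      simp only [ρ]
      rw [image_eq_zero_of_notMem_tsupport hn.1, image_eq_zero_of_notMem_tsupport hn.2]
      ring
    exact ⟨hα this, hβ this⟩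
  let φ : ℝ → ℝ := fun x => ∫ t in (0 : ℝ)..x, ρ t
  have hφd : ∀ x, HasDerivAt φ (ρ x) x := fun x =>
    hρ.continuous.integral_hasStrictDerivAt 0 x |>.hasDerivAt
  have hφ' : deriv φ = ρ := funext fun x => (hφd x).deriv
  have hφ : ContDiff ℝ ∞ φ := by
    rw [contDiff_infty_iff_deriv, hφ']
    exact ⟨fun x => (hφd x).differentiableAt, hρ⟩
  have hi1 : ∫ t in (0 : ℝ)..1, ρ t = 0 := by
    rw [intervalIntegral.integral_of_le zero_le_one, setIntegral_eq_integral_of_forall_compl_eq_zero,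
      hρ0]
    intro x hx
    by_contra hn
    have := hK x hn
    exact hx ⟨hα.trans_le this.1, this.2.trans hβ.le⟩
  have hφ0 : ∀ x, x ∉ Set.Icc α β → φ x = 0 := by
    intro x hx
    rcases lt_or_ge x α with hxα | hxα
    · refine (intervalIntegral.integral_congr fun t ht => ?_).trans
        (intervalIntegral.integral_zero (μ := volume))
      by_contra hn
      have h1 := (hK t hn).1
      have h2 := ht.2
      have h3 : (0 : ℝ) ⊔ x < α := sup_lt_iff.2 ⟨hα, hxα⟩
      linarith
    · have hxβ : β < x := by
        by_contra! hn
        exact hx ⟨hxα, hn⟩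
      have hadd := intervalIntegral.integral_add_adjacent_intervals
        (hρ.continuous.intervalIntegrable (μ := volume) 0 1)
        (hρ.continuous.intervalIntegrable (μ := volume) 1 x)
      have hz : ∫ t in (1 : ℝ)..x, ρ t = 0 := by
        refine (intervalIntegral.integral_congr fun t ht => ?_).trans
          (intervalIntegral.integral_zero (μ := volume))
        by_contra hn
        have h1 := (hK t hn).2
        have h2 := ht.1
        have h3 : β < (1 : ℝ) ⊓ x := lt_inf_iff.2 ⟨hβ, hxβ⟩
        linarith
      simp only [φ]
      rw [← hadd, hi1, hz, add_zero]
  have hφs : tsupport φ ⊆ Set.Icc α β := by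
    refine closure_minimal (fun x hx => ?_) isClosed_Icc
    by_contra hn
    exact hx (hφ0 x hn)
  have hmain := h φ hφ (isCompact_Icc.of_isClosed_subset (isClosed_tsupport φ) hφs)
    (hφs.trans fun x hx => ⟨hα.trans_le hx.1, hx.2.trans_lt hβ⟩)
  rw [hφ'] at hmain
  have iψ := LocallyIntegrableOn.integrable_mul_of_tsupport_subset hw hψ.continuous hψc hψU
  have iη := LocallyIntegrableOn.integrable_mul_of_tsupport_subset hw hη.continuous hηc hηU
  have e1 : ∫ x, w x * ρ x = (∫ x, w x * ψ x) - a * c := by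
    rw [← integral_const_mul, ← integral_sub iψ (iη.const_mul a)]
    refine integral_congr_ae (Filter.Eventually.of_forall fun x => ?_)
    simp only [ρ]
    ring
  have e2 : ∫ x, ψ x • (w x - c) = (∫ x, w x * ψ x) - a * c := by
    rw [mul_comm a c, ← integral_const_mul, ← integral_sub iψ (hψi.const_mul c)]
    refine integral_congr_ae (Filter.Eventually.of_forall fun x => ?_)
    simp only [smul_eq_mul]
    ring
  rw [e2, ← e1, hmain]

theorem continuousOn_primitive_Icc {g : ℝ → ℝ} (hg : IntegrableOn g (Set.Ioc 0 1)) :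
    ContinuousOn (fun x => ∫ t in (0 : ℝ)..x, g t) (Set.Icc 0 1) := by
  have h1 : IntegrableOn g (Set.uIcc 0 1) := by
    rw [Set.uIcc_of_le zero_le_one]
    exact integrableOn_Icc_iff_integrableOn_Ioc (by simp) |>.2 hg
  have h2 := intervalIntegral.continuousOn_primitive_interval h1
  rwa [Set.uIcc_of_le zero_le_one] at h2

/-- A continuous function on `[0, 1)` is the primitive of its integrable weak derivative. -/
theorem eq_add_primitive_of_weakDeriv {f g : ℝ → ℝ} (hf : ContinuousOn f (Set.Ico 0 1))
    (hg : IntegrableOn g (Set.Ioc 0 1))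
    (h : ∀ φ : ℝ → ℝ, ContDiff ℝ ∞ φ → HasCompactSupport φ → tsupport φ ⊆ Set.Ioo 0 1 →
      ∫ x in Set.Ico (0 : ℝ) 1, f x * deriv φ x = -∫ x in Set.Ico (0 : ℝ) 1, g x * φ x) :
    ∀ x ∈ Set.Ico (0 : ℝ) 1, f x = f 0 + ∫ t in (0 : ℝ)..x, g t := by
  let G : ℝ → ℝ := fun x => ∫ t in (0 : ℝ)..x, g t
  have hG : ContinuousOn G (Set.Ico 0 1) :=
    (continuousOn_primitive_Icc hg).mono Set.Ico_subset_Icc_self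
  have hw : ContinuousOn (fun x => f x - G x) (Set.Ico 0 1) := hf.sub hG
  have hwl : LocallyIntegrableOn (fun x => f x - G x) (Set.Ioo 0 1) :=
    (hw.mono Set.Ioo_subset_Ico_self).locallyIntegrableOn measurableSet_Ioo
  obtain ⟨c, hc⟩ := ae_eq_const_of_forall_integral_mul_deriv_eq_zero hwl (by
    intro φ hφ hφc hφU
    have hφ'c : Continuous (deriv φ) := hφ.continuous_deriv (by simp)
    have hsub : ∀ x, x ∉ Set.Ico (0 : ℝ) 1 → deriv φ x = 0 := fun x hx =>
      image_eq_zero_of_notMem_tsupport fun hn =>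
        hx (Set.Ioo_subset_Ico_self (hφU (tsupport_deriv_subset hn)))
    have hφ'U : tsupport (deriv φ) ⊆ Set.Ioo 0 1 := tsupport_deriv_subset.trans hφU
    have i1 := LocallyIntegrableOn.integrable_mul_of_tsupport_subset
      ((hf.mono Set.Ioo_subset_Ico_self).locallyIntegrableOn measurableSet_Ioo) hφ'c hφc.deriv hφ'U
    have i2 := LocallyIntegrableOn.integrable_mul_of_tsupport_subset
      ((hG.mono Set.Ioo_subset_Ico_self).locallyIntegrableOn measurableSet_Ioo) hφ'c hφc.deriv hφ'U
    have hφ1 : φ 1 = 0 := image_eq_zero_of_notMem_tsupport fun hn => lt_irrefl _ (hφU hn).2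
    have hparts := integral_primitive_mul_deriv hg
      (fun x => (hφ.differentiable (by simp) x).hasDerivAt) hφ'c
    rw [hφ1, zero_mul, zero_sub, intervalIntegral.integral_of_le zero_le_one,
      ← integral_Ico_eq_integral_Ioc, ← h φ hφ hφc hφU] at hparts
    have e1 := setIntegral_eq_integral_of_forall_compl_eq_zero (μ := volume)
      (s := Set.Ico (0 : ℝ) 1) (f := fun x => f x * deriv φ x)
      fun x hx => by rw [hsub x hx, mul_zero]
    have e2 := setIntegral_eq_integral_of_forall_compl_eq_zero (μ := volume)
      (s := Set.Ico (0 : ℝ) 1) (f := fun x => G x * deriv φ x)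
      fun x hx => by rw [hsub x hx, mul_zero]
    simp only [sub_mul]
    rw [integral_sub i1 i2, ← e1, ← e2, hparts, sub_self])
  -- Continuity upgrades almost everywhere to everywhere, including the endpoint `0`, which test
  -- functions do not see.
  have hall : ∀ x ∈ Set.Ico (0 : ℝ) 1, f x - G x = c := by
    have hae : (fun x => f x - G x) =ᵐ[volume.restrict (Set.Ico 0 1)] fun _ => c := by
      rw [← restrict_Ioo_eq_restrict_Ico]
      exact (ae_restrict_iff' measurableSet_Ioo).2 hc
    exact Measure.eqOn_Ico_of_ae_eq volume hae hw continuousOn_const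
  intro x hx
  have h0 := hall 0 ⟨le_rfl, one_pos⟩
  have hx' := hall x hx
  simp only [G, intervalIntegral.integral_same] at h0 hx'
  linarith

/-! ### Coordinates common to both spaces; bounds for the negative Sobolev norm -/

/-- A parametrization `ι` of `X` by `[0, 1)`, with inverse `σ`, that carries the Lebesgue measure
to the measure of `X`. -/
structure IcoParam {X : Type*} [MeasureSpace X] (ι : ℝ → X) (σ : X → ℝ) : Prop where
  measurable_param : Measurable ι
  measurable_coord : Measurable σ
  map_coord : (volume : Measure X).map σ = volume.restrict (Set.Ico 0 1)
  coord_mem : ∀ x, σ x ∈ Set.Ico (0 : ℝ) 1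
  param_coord : ∀ x, ι (σ x) = x
  coord_param : ∀ t ∈ Set.Ico (0 : ℝ) 1, σ (ι t) = t

namespace IcoParam

variable {X : Type*} [MeasureSpace X] {ι : ℝ → X} {σ : X → ℝ}

theorem range_coord (e : IcoParam ι σ) : Set.range σ = Set.Ico 0 1 := by
  ext t
  exact ⟨fun ⟨x, hx⟩ => hx ▸ e.coord_mem x, fun ht => ⟨ι t, e.coord_param t ht⟩⟩

theorem measurableEmbedding (e : IcoParam ι σ) : MeasurableEmbedding σ :=
  MeasurableEmbedding.of_measurable_inverse e.measurable_coord
    (e.range_coord ▸ measurableSet_Ico) e.measurable_param e.param_coord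

theorem integral_comp (e : IcoParam ι σ) (h : ℝ → ℝ) :
    ∫ x, h (σ x) = ∫ t in Set.Ico (0 : ℝ) 1, h t := by
  rw [← e.map_coord, e.measurableEmbedding.integral_map]

theorem integral_eq (e : IcoParam ι σ) (f : X → ℝ) :
    ∫ x, f x = ∫ t in Set.Ico (0 : ℝ) 1, f (ι t) := by
  rw [← e.integral_comp fun t => f (ι t)]
  simp only [e.param_coord]

theorem eLpNorm_comp (e : IcoParam ι σ) (h : ℝ → ℝ) (p : ℝ≥0∞) :
    eLpNorm (fun x => h (σ x)) p volume = eLpNorm h p (volume.restrict (Set.Ico 0 1)) := by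
  rw [← e.map_coord, e.measurableEmbedding.eLpNorm_map_measure]
  rfl

theorem integrable_iff (e : IcoParam ι σ) (f : X → ℝ) :
    Integrable f ↔ IntegrableOn (fun t => f (ι t)) (Set.Ioc 0 1) := by
  rw [IntegrableOn, ← restrict_Ico_eq_restrict_Ioc, ← e.map_coord,
    e.measurableEmbedding.integrable_map_iff]
  simp only [Function.comp_def, e.param_coord]

theorem isProbabilityMeasure (e : IcoParam ι σ) : IsProbabilityMeasure (volume : Measure X) := by
  constructor
  have : (volume : Measure X).map σ Set.univ = 1 := by simp [e.map_coord]
  rwa [Measure.map_apply e.measurable_coord .univ] at this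

theorem isProbabilityMeasure_map (e : IcoParam ι σ) (μ : Measure X) [IsProbabilityMeasure μ] :
    IsProbabilityMeasure (μ.map σ) :=
  Measure.isProbabilityMeasure_map e.measurable_coord.aemeasurable

theorem map_compl (e : IcoParam ι σ) (μ : Measure X) : μ.map σ (Set.Ico 0 1)ᶜ = 0 := by
  rw [Measure.map_apply e.measurable_coord measurableSet_Ico.compl]
  convert! measure_empty (μ := μ)
  ext x
  simpa using e.coord_mem x

end IcoParam

theorem intervalIntegral_eq_integral_Ico (f : ℝ → ℝ) :
    ∫ t in (0 : ℝ)..1, f t = ∫ t in Set.Ico (0 : ℝ) 1, f t := by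
  rw [intervalIntegral.integral_of_le zero_le_one, integral_Ico_eq_integral_Ioc]

/-- Hölder upper bound for the negative Sobolev norm. -/
theorem negSobolevNorm_le_eLpNorm {X : Type*} [TopologicalSpace X] [MeasureSpace X]
    {ι : ℝ → X} {σ : X → ℝ} (e : IcoParam ι σ) {D : (X → ℝ) → (X → ℝ) → Prop} {y : ℝ}
    (hmeas : ∀ f g, D f g → AEStronglyMeasurable g volume)
    (hprim : ∀ f g, Continuous f → D f g → Integrable g →
      (∀ x ∈ Set.Ico (0 : ℝ) 1, f (ι x) = f (ι 0) + ∫ t in (0 : ℝ)..x, g (ι t)) ∧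
      y * ∫ x, g x = 0)
    (μ : Measure X) [IsProbabilityMeasure μ] {p : ℝ≥0∞} (hp : 1 ≤ p) :
    negSobolevNorm D p μ ≤ eLpNorm (fun x => quasiCdf (μ.map σ) (σ x) - σ x - y) p volume := by
  have := e.isProbabilityMeasure
  have := e.isProbabilityMeasure_map μ
  have hpq := ENNReal.HolderConjugate.conjExponent hp
  set m := μ.map σ with hm
  set d : X → ℝ := fun x => quasiCdf m (σ x) - σ x with hd
  have hdm : Measurable d :=
    ((measurable_quasiCdf m).comp e.measurable_coord).sub e.measurable_coord
  refine iSup_le fun f => iSup_le fun hf => iSup_le fun hs => ?_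
  -- The seminorm is an infimum, so a weak derivative is only at hand with norm below a given `c >
  -- 1`; in the end `c ↓ 1`.
  have key : ∀ c > 1, ENNReal.ofReal ((∫ x, f x ∂μ) - ∫ x, f x) ≤
      c * eLpNorm (fun x => d x - y) p volume := by
    intro c hc
    obtain ⟨g, hg⟩ := iInf_lt_iff.1 (hs.trans_lt hc)
    obtain ⟨hDg, hgc⟩ := iInf_lt_iff.1 hg
    have hgm := hmeas f g hDg
    have hgi : Integrable g := by
      rw [← memLp_one_iff_integrable]
      refine MemLp.mono_exponent (q := ENNReal.conjExponent p) ⟨hgm, hgc.trans_le le_top⟩ ?_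
      exact ENNReal.HolderConjugate.one_le _ p
    obtain ⟨hfg, hy⟩ := hprim f g hf hDg hgi
    have h1 := integral_sub_integral_primitive (e.map_compl μ)
      (f := fun t => f (ι t)) ((e.integrable_iff g).1 hgi) hfg
    rw [e.measurableEmbedding.integral_map] at h1
    simp only [e.param_coord] at h1
    have hdg : Integrable fun x => d x * g x := by
      refine hgi.bdd_mul (c := 1) hdm.aestronglyMeasurable (Filter.Eventually.of_forall fun x => ?_)
      exact abs_quasiCdf_sub_le _
    -- The shift is free because `y * ∫ g = 0`: on the interval `y = 0`, on the circle `g` has mean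
    -- zero.
    have h2 : ∫ t in (0 : ℝ)..1, (quasiCdf m t - t) * g (ι t) = ∫ x, (d x - y) * g x := by
      simp only [sub_mul (d _)]
      rw [integral_sub hdg (hgi.const_mul y), integral_const_mul, hy, sub_zero, e.integral_eq,
        intervalIntegral_eq_integral_Ico]
      refine setIntegral_congr_fun measurableSet_Ico fun t ht => ?_
      simp only [hd, e.coord_param t ht]
    rw [← e.integral_eq, h2] at h1
    rw [h1]
    calc ENNReal.ofReal (-∫ x, (d x - y) * g x)
        ≤ ‖∫ x, (d x - y) * g x‖ₑ := by
          rw [Real.enorm_eq_ofReal_abs]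
          exact ENNReal.ofReal_le_ofReal (neg_le_abs _)
      _ ≤ ∫⁻ x, ‖(d x - y) * g x‖ₑ := enorm_integral_le_lintegral_enorm _
      _ = eLpNorm ((fun x => d x - y) • g) 1 volume := by
          rw [eLpNorm_one_eq_lintegral_enorm]
          rfl
      _ ≤ eLpNorm (fun x => d x - y) p volume * eLpNorm g (ENNReal.conjExponent p) volume :=
          eLpNorm_smul_le_mul_eLpNorm hgm (hdm.sub_const y).aestronglyMeasurable
      _ ≤ c * eLpNorm (fun x => d x - y) p volume := by
          rw [mul_comm]
          gcongr
  have h1 : ENNReal.ofReal ((∫ x, f x ∂μ) - ∫ x, f x) / eLpNorm (fun x => d x - y) p volume ≤ 1 :=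
    le_of_forall_gt_imp_ge_of_dense fun c hc => ENNReal.div_le_of_le_mul (key c hc)
  simpa using (ENNReal.div_le_iff_le_mul (Or.inr ENNReal.one_ne_top) (Or.inr one_ne_zero)).1 h1

/-- A test function for the negative Sobolev norm, given as a primitive. -/
theorem le_negSobolevNorm_of_primitive {X : Type*} [TopologicalSpace X] [MeasureSpace X]
    {ι : ℝ → X} {σ : X → ℝ} (e : IcoParam ι σ) {D : (X → ℝ) → (X → ℝ) → Prop}
    {g : ℝ → ℝ} (hg : IntegrableOn g (Set.Ioc 0 1))
    (hcont : Continuous fun x => ∫ t in (0 : ℝ)..(σ x), g t)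
    (hD : D (fun x => ∫ t in (0 : ℝ)..(σ x), g t) (fun x => g (σ x)))
    (μ : Measure X) [IsProbabilityMeasure μ] {p : ℝ≥0∞}
    (hgq : eLpNorm g (ENNReal.conjExponent p) (volume.restrict (Set.Ico 0 1)) ≤ 1) :
    ENNReal.ofReal (-∫ t in (0 : ℝ)..1, (quasiCdf (μ.map σ) t - t) * g t) ≤
      negSobolevNorm D p μ := by
  have := e.isProbabilityMeasure_map μ
  have h1 := integral_sub_integral_primitive (e.map_compl μ)
      (f := fun s => ∫ t in (0 : ℝ)..s, g t) hg (fun x _ => by simp)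
  rw [e.measurableEmbedding.integral_map, ← e.integral_comp] at h1
  rw [← h1]
  refine le_iSup₂_of_le (fun x => ∫ t in (0 : ℝ)..(σ x), g t) hcont (le_iSup_of_le ?_ le_rfl)
  exact (iInf₂_le _ hD).trans (by rwa [e.eLpNorm_comp])

/-- The conjugate of `⊤` is `1`, and on a probability space the `L¹` constraint on the derivative is
the weakest. -/
theorem negSobolevNorm_mono_top {X : Type*} [TopologicalSpace X] [MeasureSpace X]
    [IsProbabilityMeasure (volume : Measure X)] {D : (X → ℝ) → (X → ℝ) → Prop}
    (hmeas : ∀ f g, D f g → AEStronglyMeasurable g volume) (μ : Measure X) (p : ℝ≥0∞) : negSobolevNorm D p μ ≤ negSobolevNorm D ⊤ μ := by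
  refine iSup_mono fun f => iSup_mono fun hf => iSup_mono' fun hs => ⟨le_trans ?_ hs, le_rfl⟩
  refine iInf₂_mono fun g hg => eLpNorm_le_eLpNorm_of_exponent_le ?_ (hmeas f g hg)
  simp [ENNReal.conjExponent]

section Model

variable {m : Measure ℝ} [IsProbabilityMeasure m]

theorem eLpNorm_eq_ofReal_integral_rpow {h : ℝ → ℝ} (hh : Measurable h) {C : ℝ}
    (hC : ∀ t, |h t| ≤ C) {p : ℝ≥0∞} (hp : p ≠ 0) (hp' : p ≠ ⊤) :
    eLpNorm h p (volume.restrict (Set.Ico 0 1)) =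
      ENNReal.ofReal (∫ t in (0 : ℝ)..1, |h t| ^ p.toReal) ^ p.toReal⁻¹ := by
  have hmem : MemLp h p (volume.restrict (Set.Ico 0 1)) :=
    MemLp.of_bound hh.aestronglyMeasurable C (Filter.Eventually.of_forall hC)
  rw [hmem.eLpNorm_eq_integral_rpow_norm hp hp', ENNReal.ofReal_rpow_of_nonneg,
    intervalIntegral_eq_integral_Ico]
  · rfl
  · exact intervalIntegral.integral_nonneg zero_le_one fun t _ => by positivity
  · positivity

theorem abs_quasiCdf_sub_sub_le {y : ℝ} (hy : |y| ≤ 1) (t : ℝ) : |quasiCdf m t - t - y| ≤ 2 :=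
  (abs_sub _ _).trans (by linarith [abs_quasiCdf_sub_le (m := m) t])

theorem measurable_quasiCdf_sub_sub (y : ℝ) : Measurable fun t => quasiCdf m t - t - y :=
  ((measurable_quasiCdf m).sub measurable_id).sub_const y

theorem eLpNorm_quasiCdf_sub_sub {y : ℝ} (hy : |y| ≤ 1) {r : ℝ} (hr : 0 < r) :
    eLpNorm (fun t => quasiCdf m t - t - y) (ENNReal.ofReal r) (volume.restrict (Set.Ico 0 1)) =
      ENNReal.ofReal (∫ t in (0 : ℝ)..1, |quasiCdf m t - t - y| ^ r) ^ r⁻¹ := by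
  rw [eLpNorm_eq_ofReal_integral_rpow (measurable_quasiCdf_sub_sub y) (abs_quasiCdf_sub_sub_le hy)
    (by simpa using hr) ENNReal.ofReal_ne_top, ENNReal.toReal_ofReal hr.le]

theorem abs_signedPow_quasiCdf_le {y : ℝ} (hy : |y| ≤ 1) {r : ℝ} (hr : 1 < r) (t : ℝ) :
    |signedPow r (quasiCdf m t - t - y)| ≤ 2 ^ (r - 1) := by
  rw [abs_signedPow hr]
  exact Real.rpow_le_rpow (abs_nonneg _) (abs_quasiCdf_sub_sub_le hy t) (by linarith)

theorem measurable_signedPow_quasiCdf (y : ℝ) {r : ℝ} (hr : 1 < r) :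
    Measurable fun t => signedPow r (quasiCdf m t - t - y) :=
  (continuous_signedPow hr).measurable.comp (measurable_quasiCdf_sub_sub y)

end Model

/-- Lower bound for the negative Sobolev norm by the optimal test function for the exponent `r`. -/
theorem ofReal_div_le_negSobolevNorm {X : Type*} [TopologicalSpace X] [MeasureSpace X]
    {ι : ℝ → X} {σ : X → ℝ} (e : IcoParam ι σ) {D : (X → ℝ) → (X → ℝ) → Prop} {y z : ℝ}
    (hyz : y * z = y)
    (hprim : ∀ g : ℝ → ℝ, IntegrableOn g (Set.Ioc 0 1) → z * ∫ t in (0 : ℝ)..1, g t = 0 →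
      Continuous (fun x => ∫ t in (0 : ℝ)..(σ x), g t) ∧
      D (fun x => ∫ t in (0 : ℝ)..(σ x), g t) (fun x => g (σ x)))
    (μ : Measure X) [IsProbabilityMeasure μ] (hy : |y| ≤ 1) {r : ℝ} (hr : 1 < r)
    (h0 : z * ∫ t in (0 : ℝ)..1, signedPow r (quasiCdf (μ.map σ) t - t - y) = 0)
    {p : ℝ≥0∞} {c : ℝ} (hc : 0 < c)
    (hle : eLpNorm (fun t => signedPow r (quasiCdf (μ.map σ) t - t - y)) (ENNReal.conjExponent p)
      (volume.restrict (Set.Ico 0 1)) ≤ ENNReal.ofReal c) :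
    ENNReal.ofReal ((∫ t in (0 : ℝ)..1, |quasiCdf (μ.map σ) t - t - y| ^ r) / c) ≤
      negSobolevNorm D p μ := by
  have := e.isProbabilityMeasure_map μ
  set m := μ.map σ
  set k : ℝ → ℝ := fun t => signedPow r (quasiCdf m t - t - y) with hk
  have hki : IntegrableOn k (Set.Ioc 0 1) := by
    refine Integrable.of_bound (C := 2 ^ (r - 1))
      (measurable_signedPow_quasiCdf y hr).aestronglyMeasurable
      (Filter.Eventually.of_forall fun t => ?_)
    exact abs_signedPow_quasiCdf_le hy hr t
  have hki' : IntervalIntegrable k volume 0 1 :=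
    (intervalIntegrable_iff_integrableOn_Ioc_of_le zero_le_one).2 hki
  -- The sign compensates the minus in the pairing formula, and `c` normalizes the conjugate norm.
  let g : ℝ → ℝ := fun t => (-c⁻¹) * k t
  have hg : IntegrableOn g (Set.Ioc 0 1) := hki.const_mul _
  have hg0 : z * ∫ t in (0 : ℝ)..1, g t = 0 := by
    rw [intervalIntegral.integral_const_mul, mul_left_comm, h0, mul_zero]
  obtain ⟨hcont, hD⟩ := hprim g hg hg0
  have hgq : eLpNorm g (ENNReal.conjExponent p) (volume.restrict (Set.Ico 0 1)) ≤ 1 := by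
    have : g = (-c⁻¹) • k := rfl
    rw [this, eLpNorm_const_smul, enorm_neg, Real.enorm_of_nonneg (by positivity)]
    calc ENNReal.ofReal c⁻¹ * eLpNorm k (ENNReal.conjExponent p) (volume.restrict (Set.Ico 0 1))
        ≤ ENNReal.ofReal c⁻¹ * ENNReal.ofReal c := by gcongr
      _ = 1 := by
        rw [← ENNReal.ofReal_mul (by positivity), inv_mul_cancel₀ hc.ne', ENNReal.ofReal_one]
  refine le_trans (ENNReal.ofReal_le_ofReal (le_of_eq ?_))
    (le_negSobolevNorm_of_primitive e hg hcont hD μ hgq)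
  have hDk : IntervalIntegrable (fun t => (quasiCdf m t - t) * k t) volume 0 1 :=
    (intervalIntegrable_iff_integrableOn_Ioc_of_le zero_le_one).2
      (integrableOn_quasiCdf_sub_mul m hki)
  -- The term `y * ∫ k` vanishes because `y = y * z` and `z * ∫ k = 0`. This covers the interval (`y
  -- = z = 0`) and the circle (`z = 1`) at once.
  have h1 : ∫ t in (0 : ℝ)..1, |quasiCdf m t - t - y| ^ r =
      ∫ t in (0 : ℝ)..1, (quasiCdf m t - t) * k t := by
    simp only [← mul_signedPow hr, sub_mul _ y]
    rw [intervalIntegral.integral_sub hDk (hki'.const_mul y), intervalIntegral.integral_const_mul,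
      ← hyz, mul_assoc, h0, mul_zero, sub_zero]
  rw [h1, div_eq_inv_mul, ← intervalIntegral.integral_const_mul, ← intervalIntegral.integral_neg]
  refine intervalIntegral.integral_congr fun t _ => ?_
  simp only [g]
  ring

/-- The bounds on the negative Sobolev norm needed for `iInf_eLpNorm_sub_le`. -/
theorem eLpNorm_le_negSobolevNorm {X : Type*} [TopologicalSpace X] [MeasureSpace X]
    {ι : ℝ → X} {σ : X → ℝ} (e : IcoParam ι σ) {D : (X → ℝ) → (X → ℝ) → Prop} {y z : ℝ}
    (hyz : y * z = y)
    (hprim : ∀ g : ℝ → ℝ, IntegrableOn g (Set.Ioc 0 1) → z * ∫ t in (0 : ℝ)..1, g t = 0 →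
      Continuous (fun x => ∫ t in (0 : ℝ)..(σ x), g t) ∧
      D (fun x => ∫ t in (0 : ℝ)..(σ x), g t) (fun x => g (σ x)))
    (μ : Measure X) [IsProbabilityMeasure μ] (hy : |y| ≤ 1) {r : ℝ} (hr : 1 < r)
    (h0 : z * ∫ t in (0 : ℝ)..1, signedPow r (quasiCdf (μ.map σ) t - t - y) = 0) :
    eLpNorm (fun t => quasiCdf (μ.map σ) t - t - y) (ENNReal.ofReal r)
      (volume.restrict (Set.Ico 0 1)) ≤ negSobolevNorm D (ENNReal.ofReal r) μ ∧
    eLpNorm (fun t => quasiCdf (μ.map σ) t - t - y) (ENNReal.ofReal r)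
      (volume.restrict (Set.Ico 0 1)) ^ r ≤ 2 ^ (r - 1) * negSobolevNorm D 1 μ := by
  have := e.isProbabilityMeasure_map μ
  have hr0 : 0 < r := by linarith
  set m := μ.map σ
  rw [eLpNorm_quasiCdf_sub_sub hy hr0]
  set J := ∫ t in (0 : ℝ)..1, |quasiCdf m t - t - y| ^ r with hJ
  have hJ0 : 0 ≤ J := intervalIntegral.integral_nonneg zero_le_one fun t _ => by positivity
  have hr1 : (1 : ℝ≥0∞) ≤ ENNReal.ofReal r := by
    rw [← ENNReal.ofReal_one]
    exact ENNReal.ofReal_le_ofReal hr.le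
  constructor
  · rcases hJ0.eq_or_lt with hJ0 | hJ0
    · rw [← hJ0, ENNReal.ofReal_zero, ENNReal.zero_rpow_of_pos (by positivity)]
      exact zero_le
    have hconj := ENNReal.HolderConjugate.conjExponent hr1
    set q := ENNReal.conjExponent (ENNReal.ofReal r)
    have hs : r.HolderConjugate q.toReal := by
      have := ENNReal.HolderConjugate.toReal (p := ENNReal.ofReal r) (q := q)
        (by rwa [ENNReal.toReal_ofReal hr0.le])
      rwa [ENNReal.toReal_ofReal hr0.le] at this
    have hqtop : q ≠ ⊤ := fun h => by
      have := hs.symm.pos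
      simp [h] at this
    have hq0 : q ≠ 0 := fun h => by
      have := hs.symm.pos
      simp [h] at this
    -- Since `(r - 1) q = r`, the conjugate norm is `J ^ (1 / q)`, and `J / J ^ (1 / q) = J ^ (1 /
    -- r)`.
    have hk : eLpNorm (fun t => signedPow r (quasiCdf m t - t - y)) q
        (volume.restrict (Set.Ico 0 1)) ≤ ENNReal.ofReal (J ^ q.toReal⁻¹) := by
      rw [eLpNorm_eq_ofReal_integral_rpow (measurable_signedPow_quasiCdf y hr)
        (abs_signedPow_quasiCdf_le hy hr) hq0 hqtop, ENNReal.ofReal_rpow_of_nonneg _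
        (inv_nonneg.2 ENNReal.toReal_nonneg)]
      · refine ENNReal.ofReal_le_ofReal (le_of_eq ?_)
        congr 1
        refine intervalIntegral.integral_congr fun t _ => ?_
        rw [abs_signedPow hr, ← Real.rpow_mul (abs_nonneg _), hs.sub_one_mul_conj]
      · exact intervalIntegral.integral_nonneg zero_le_one fun t _ => by positivity
    have := ofReal_div_le_negSobolevNorm e hyz hprim μ hy hr h0 (by positivity) hk
    rw [ENNReal.ofReal_rpow_of_nonneg hJ0.le (by positivity)]
    refine le_trans (ENNReal.ofReal_le_ofReal (le_of_eq ?_)) this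
    rw [eq_div_iff (by positivity), ← Real.rpow_add hJ0, hs.inv_add_inv_eq_one, Real.rpow_one]
  -- For `p = 1` the conjugate exponent is `⊤`; the constant comes from `|quasiCdf m t - t - y| ≤
  -- 2`.
  · have hk : eLpNorm (fun t => signedPow r (quasiCdf m t - t - y)) (ENNReal.conjExponent 1)
        (volume.restrict (Set.Ico 0 1)) ≤ ENNReal.ofReal (2 ^ (r - 1)) := by
      have h1 : ENNReal.conjExponent 1 = ⊤ := by simp [ENNReal.conjExponent]
      rw [h1, eLpNorm_exponent_top]
      refine eLpNormEssSup_le_of_ae_bound (Filter.Eventually.of_forall fun t => ?_)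
      exact abs_signedPow_quasiCdf_le hy hr t
    have := ofReal_div_le_negSobolevNorm e hyz hprim μ hy hr h0 (by positivity) hk
    rw [ENNReal.rpow_inv_rpow hr0.ne']
    rw [ENNReal.ofReal_div_of_pos (by positivity), ENNReal.div_le_iff (by simp; positivity)
      ENNReal.ofReal_ne_top, mul_comm, ← ENNReal.ofReal_rpow_of_pos two_pos] at this
    simpa using this

/-! ### Quantile couplings and bounds for the Wasserstein distance to the uniform measure -/

section Model

variable {m : Measure ℝ} [IsProbabilityMeasure m]

theorem lintegral_quasiQuantile_eq (y : ℝ) {r : ℝ} (hr : 1 ≤ r) :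
    ∫⁻ t in Set.Ico (0 : ℝ) 1, ENNReal.ofReal (|quasiQuantile m (t + y) - t| ^ r) =
      ∫⁻ t in Set.Ico (0 : ℝ) 1, ENNReal.ofReal (|quasiCdf m t - t - y| ^ r) := by
  have := (inversePair_quasiCdf (m := m) |>.translate y).lintegral_rpow_eq hr
  rw [restrict_Ico_eq_restrict_Ioc, this]
  simp only [sub_right_comm]

theorem measurable_quasiQuantile (m : Measure ℝ) [IsProbabilityMeasure m] :
    Measurable (quasiQuantile m) :=
  inversePair_quasiCdf.monotone_right.measurable

theorem measurable_quasiQuantile_add_sub (m : Measure ℝ) [IsProbabilityMeasure m] (y : ℝ) :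
    Measurable fun t => quasiQuantile m (t + y) - t :=
  ((measurable_quasiQuantile m).comp (measurable_id.add_const y)).sub measurable_id

theorem eLpNorm_quasiQuantile_of_ne_top (y : ℝ) {p : ℝ≥0∞} (hp : 1 ≤ p) (hp' : p ≠ ⊤) :
    eLpNorm (fun t => quasiQuantile m (t + y) - t) p (volume.restrict (Set.Ico 0 1)) =
      eLpNorm (fun t => quasiCdf m t - t - y) p (volume.restrict (Set.Ico 0 1)) := by
  have hp0 : p ≠ 0 := (one_pos.trans_le hp).ne'
  have hr : 1 ≤ p.toReal := by
    rw [← ENNReal.toReal_one]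
    exact ENNReal.toReal_mono hp' hp
  rw [eLpNorm_eq_lintegral_rpow_enorm_toReal hp0 hp', eLpNorm_eq_lintegral_rpow_enorm_toReal hp0 hp']
  simp only [Real.enorm_eq_ofReal_abs, ENNReal.ofReal_rpow_of_nonneg (abs_nonneg _)
    (zero_le_one.trans hr)]
  rw [lintegral_quasiQuantile_eq y hr]

/-- Finite exponents give equality by the area identity; `⊤` follows from them by a limit, where one
inequality suffices. -/
theorem eLpNorm_quasiQuantile_le (y : ℝ) {p : ℝ≥0∞} (hp : 1 ≤ p) :
    eLpNorm (fun t => quasiQuantile m (t + y) - t) p (volume.restrict (Set.Ico 0 1)) ≤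
      eLpNorm (fun t => quasiCdf m t - t - y) p (volume.restrict (Set.Ico 0 1)) := by
  rcases eq_or_ne p ⊤ with rfl | hp'
  · refine eLpNorm_top_le_of_forall_eLpNorm_le
      (measurable_quasiQuantile_add_sub m y).aestronglyMeasurable fun n hn => ?_
    rw [eLpNorm_quasiQuantile_of_ne_top y (by exact_mod_cast (by omega : 1 ≤ n))
      (ENNReal.natCast_ne_top n)]
    exact eLpNorm_le_eLpNorm_of_exponent_le le_top
      (measurable_quasiCdf_sub_sub y).aestronglyMeasurable
  · exact (eLpNorm_quasiQuantile_of_ne_top y hp hp').le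

end Model

namespace IcoParam

theorem measurePreserving_quantile {X : Type*} [MeasureSpace X] {ι : ℝ → X} {σ : X → ℝ}
    (e : IcoParam ι σ) (μ : Measure X) [IsProbabilityMeasure μ] :
    MeasurePreserving (fun x => ι (quasiQuantile (μ.map σ) (σ x))) volume μ := by
  have := e.isProbabilityMeasure_map μ
  have hT := measurable_quasiQuantile (μ.map σ)
  refine ⟨e.measurable_param.comp (hT.comp e.measurable_coord), ?_⟩
  change Measure.map (ι ∘ quasiQuantile (μ.map σ) ∘ σ) volume = μ
  rw [← Measure.map_map e.measurable_param (hT.comp e.measurable_coord),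
    ← Measure.map_map hT e.measurable_coord, e.map_coord, map_quasiQuantile (e.map_compl μ),
    Measure.map_map e.measurable_param e.measurable_coord,
    show ι ∘ σ = id from funext e.param_coord, Measure.map_id]

variable {X : Type*} [PseudoMetricSpace X] [SecondCountableTopology X] [MeasureSpace X]
  [BorelSpace X] {ι : ℝ → X} {σ : X → ℝ}

/-- Upper bound for the Wasserstein distance by the monotone coupling with shift `y`. -/
theorem wasserstein_le_eLpNorm (e : IcoParam ι σ) (μ : Measure X) [IsProbabilityMeasure μ]
    (y : ℝ) {τ : X → X} (hτ : MeasurePreserving τ volume μ)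
    (hdist : ∀ u, dist (τ u) u ≤ |quasiQuantile (μ.map σ) (σ u + y) - σ u|)
    {p : ℝ≥0∞} (hp : 1 ≤ p) :
    wasserstein p μ volume ≤
      eLpNorm (fun x => quasiCdf (μ.map σ) (σ x) - σ x - y) p volume := by
  have := e.isProbabilityMeasure_map μ
  calc wasserstein p μ volume ≤ eLpNorm (fun u => dist (τ u) u) p volume :=
        wasserstein_le_of_measurePreserving hτ p
    _ ≤ eLpNorm (fun u => quasiQuantile (μ.map σ) (σ u + y) - σ u) p volume :=
        eLpNorm_mono fun u => by
          rw [Real.norm_of_nonneg dist_nonneg]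
          exact hdist u
    _ = eLpNorm (fun t => quasiQuantile (μ.map σ) (t + y) - t) p
          (volume.restrict (Set.Ico 0 1)) :=
        e.eLpNorm_comp (fun t => quasiQuantile (μ.map σ) (t + y) - t) p
    _ ≤ _ := eLpNorm_quasiQuantile_le y hp
    _ = _ := (e.eLpNorm_comp (fun t => quasiCdf (μ.map σ) t - t - y) p).symm

/-- The bounds on the Wasserstein distance needed for `iInf_eLpNorm_sub_le`. -/
theorem eLpNorm_le_wasserstein (e : IcoParam ι σ) (μ : Measure X) [IsProbabilityMeasure μ]
    (hX : ∀ x y : X, dist x y ≤ 1) {y : ℝ} (hy : |y| ≤ 1) {r : ℝ} (hr : 1 < r) {τ : X → X}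
    (hτ : MeasurePreserving τ volume μ)
    (hle : ∀ x u, InversePair.potential (fun s => quasiCdf (μ.map σ) s - y) r (σ x) +
      (|quasiQuantile (μ.map σ) (σ u + y) - σ u| ^ r -
        InversePair.potential (fun s => quasiCdf (μ.map σ) s - y) r (σ (τ u))) ≤ dist x u ^ r) :
    eLpNorm (fun t => quasiCdf (μ.map σ) t - t - y) (ENNReal.ofReal r)
      (volume.restrict (Set.Ico 0 1)) ≤ wasserstein (ENNReal.ofReal r) μ volume ∧
    eLpNorm (fun t => quasiCdf (μ.map σ) t - t - y) (ENNReal.ofReal r)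
      (volume.restrict (Set.Ico 0 1)) ^ r ≤ 2 ^ (r - 1) * wasserstein 1 μ volume := by
  have := e.isProbabilityMeasure_map μ
  have := e.isProbabilityMeasure
  have hr0 : 0 < r := by linarith
  set m := μ.map σ with hm
  have hpair := (inversePair_quasiCdf (m := m)).translate y
  set ψ := InversePair.potential (fun s => quasiCdf m s - y) r with hψ
  have hψc : Continuous ψ := hpair.continuous_potential hr
  have hφ : Integrable (fun x => ψ (σ x)) μ := by
    obtain ⟨C, hC⟩ := isCompact_Icc.exists_bound_of_continuousOn (hψc.continuousOn
      (s := Set.Icc 0 1))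
    exact Integrable.of_bound (hψc.measurable.comp e.measurable_coord).aestronglyMeasurable C
      (Filter.Eventually.of_forall fun x => hC _ (Set.Ico_subset_Icc_self (e.coord_mem x)))
  have hcost : ∫⁻ u, ENNReal.ofReal (|quasiQuantile m (σ u + y) - σ u| ^ r) =
      eLpNorm (fun t => quasiCdf m t - t - y) (ENNReal.ofReal r)
        (volume.restrict (Set.Ico 0 1)) ^ r := by
    have h1 : ∫⁻ u, ENNReal.ofReal (|quasiQuantile m (σ u + y) - σ u| ^ r) =
        ∫⁻ t in Set.Ico (0 : ℝ) 1, ENNReal.ofReal (|quasiQuantile m (t + y) - t| ^ r) := by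
      rw [← e.map_coord, e.measurableEmbedding.lintegral_map]
    rw [h1, lintegral_quasiQuantile_eq y hr.le,
      eLpNorm_eq_lintegral_rpow_enorm_toReal (by simpa using hr0) ENNReal.ofReal_ne_top,
      ENNReal.toReal_ofReal hr0.le, one_div, ENNReal.rpow_inv_rpow hr0.ne']
    simp only [Real.enorm_eq_ofReal_abs, ENNReal.ofReal_rpow_of_nonneg (abs_nonneg _) hr0.le]
  have hmeas : Measurable fun u => |quasiQuantile m (σ u + y) - σ u| ^ r :=
    (((measurable_quasiQuantile_add_sub m y).comp e.measurable_coord).abs).pow_const r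
  have he : Integrable (fun u => |quasiQuantile m (σ u + y) - σ u| ^ r) := by
    refine ⟨hmeas.aestronglyMeasurable, ?_⟩
    rw [hasFiniteIntegral_iff_ofReal (Filter.Eventually.of_forall fun u => by positivity), hcost]
    refine ENNReal.rpow_lt_top_of_nonneg hr0.le ?_
    exact (MemLp.of_bound (measurable_quasiCdf_sub_sub y).aestronglyMeasurable 2
      (Filter.Eventually.of_forall fun t => abs_quasiCdf_sub_sub_le hy t)).2.ne
  obtain ⟨h1, h2⟩ := le_wasserstein_of_potential hX hτ hφ he hr hle
  rw [ofReal_integral_eq_lintegral_ofReal he (Filter.Eventually.of_forall fun u => by positivity),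
    hcost] at h1 h2
  refine ⟨(ENNReal.rpow_le_rpow_iff hr0).1 h1, h2.trans ?_⟩
  -- The factor `2 ^ (r - 1)` is slack here; it is needed only for the Sobolev norm, which shares
  -- the form of the bound.
  exact le_mul_of_one_le_left zero_le (ENNReal.one_le_rpow one_le_two (by linarith))

end IcoParam

/-! ### The interval -/

section Ico

/-- The parametrization of `[0, 1)` by the fractional part. -/
noncomputable def fractIco (t : ℝ) : UnitIco := ⟨Int.fract t, Int.fract_nonneg t, Int.fract_lt_one t⟩

theorem icoParam_unitIco : IcoParam fractIco ((↑) : UnitIco → ℝ) where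
  measurable_param := measurable_fract.subtype_mk
  measurable_coord := measurable_subtype_coe
  map_coord := map_comap_subtype_coe measurableSet_Ico volume
  coord_mem x := x.2
  param_coord x := Subtype.ext (Int.fract_eq_self.2 x.2)
  coord_param _ ht := Int.fract_eq_self.2 ht

theorem continuousOn_fractIco : ContinuousOn fractIco (Set.Ico 0 1) := by
  rw [continuousOn_iff_continuous_domRestrict]
  convert! continuous_id (X := UnitIco)
  ext x
  exact Int.fract_eq_self.2 x.2

/-- Local integrability is only assumed on `(0, 1)`, but the remaining point `0` is null. -/
theorem HasWeakDerivIco.aestronglyMeasurable {f g : UnitIco → ℝ} (h : HasWeakDerivIco f g) :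
    AEStronglyMeasurable g volume := by
  have hm := h.2.1.aestronglyMeasurable
  have hnull : volume {x : UnitIco | 0 < (x : ℝ)}ᶜ = 0 := by
    have hs : MeasurableSet (Set.Iic (0 : ℝ)) := measurableSet_Iic
    have h0 : {x : UnitIco | 0 < (x : ℝ)}ᶜ = (↑) ⁻¹' Set.Iic (0 : ℝ) := by
      ext x
      simp
    rw [h0, ← Measure.map_apply measurable_subtype_coe hs, icoParam_unitIco.map_coord,
      Measure.restrict_apply hs]
    refine measure_mono_null (t := {0}) (fun x hx => ?_) Real.volume_singleton
    exact le_antisymm hx.1 hx.2.1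
  rwa [Measure.restrict_eq_self_of_ae_mem (show ∀ᵐ x, x ∈ {x : UnitIco | 0 < (x : ℝ)} from hnull)]
    at hm

theorem integral_mul_comp_coe (f : UnitIco → ℝ) (φ : ℝ → ℝ) :
    ∫ x : UnitIco, f x * φ x = ∫ t in Set.Ico (0 : ℝ) 1, f (fractIco t) * φ t := by
  rw [icoParam_unitIco.integral_eq]
  refine setIntegral_congr_fun measurableSet_Ico fun t ht => ?_
  simp only [icoParam_unitIco.coord_param t ht]

theorem HasWeakDerivIco.eq_add_primitive {f g : UnitIco → ℝ} (hf : Continuous f)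
    (h : HasWeakDerivIco f g) (hg : Integrable g) :
    ∀ x ∈ Set.Ico (0 : ℝ) 1,
      f (fractIco x) = f (fractIco 0) + ∫ t in (0 : ℝ)..x, g (fractIco t) := by
  refine eq_add_primitive_of_weakDeriv (hf.comp_continuousOn continuousOn_fractIco)
    ((icoParam_unitIco.integrable_iff g).1 hg) fun φ hφ hc hs => ?_
  have := h.2.2 φ hφ hc hs
  rwa [integral_mul_comp_coe, integral_mul_comp_coe] at this

theorem hasWeakDerivIco_primitive {g : ℝ → ℝ} (hg : IntegrableOn g (Set.Ioc 0 1)) :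
    Continuous (fun x : UnitIco => ∫ t in (0 : ℝ)..x, g t) ∧
      HasWeakDerivIco (fun x : UnitIco => ∫ t in (0 : ℝ)..x, g t) (fun x => g x) := by
  have hcont : Continuous (fun x : UnitIco => ∫ t in (0 : ℝ)..x, g t) :=
    (continuousOn_iff_continuous_domRestrict.1
      ((continuousOn_primitive_Icc hg).mono Set.Ico_subset_Icc_self))
  have := icoParam_unitIco.isProbabilityMeasure
  refine ⟨hcont, hcont.locallyIntegrable.locallyIntegrableOn _, ?_, fun φ hφ hc hs => ?_⟩
  · refine Integrable.locallyIntegrable ?_ |>.locallyIntegrableOn _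
    have h1 : IntegrableOn g (Set.Ico 0 1) := by
      rwa [IntegrableOn, restrict_Ico_eq_restrict_Ioc]
    rw [IntegrableOn, ← icoParam_unitIco.map_coord,
      icoParam_unitIco.measurableEmbedding.integrable_map_iff] at h1
    exact h1
  · have hφ1 : φ 1 = 0 := image_eq_zero_of_notMem_tsupport fun hn => lt_irrefl _ (hs hn).2
    have h1 := integral_primitive_mul_deriv hg
      (fun x => (hφ.differentiable (by simp) x).hasDerivAt) (hφ.continuous_deriv (by simp))
    rw [hφ1, zero_mul, zero_sub, intervalIntegral_eq_integral_Ico] at h1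
    rw [icoParam_unitIco.integral_comp (fun t => (∫ s in (0 : ℝ)..t, g s) * deriv φ t),
      icoParam_unitIco.integral_comp (fun t => g t * φ t), h1]

theorem map_coe_Iio (μ : Measure UnitIco) [IsProbabilityMeasure μ] (x : UnitIco) :
    quasiCdf (μ.map (↑)) x - x = discrepancy μ x := by
  have := icoParam_unitIco.isProbabilityMeasure_map μ
  rw [quasiCdf_eq (icoParam_unitIco.map_compl μ) (Set.Ico_subset_Icc_self x.2), discrepancy,
    map_measureReal_apply measurable_subtype_coe measurableSet_Iio]
  rfl

/-- The formulas for the Wasserstein distance and the negative Sobolev norm on the interval. -/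
theorem wasserstein_eq_eLpNorm_discrepancy {p : ℝ≥0∞} (hp : 1 ≤ p) (μ : Measure UnitIco)
    [IsProbabilityMeasure μ] :
    wasserstein p μ volume = eLpNorm (discrepancy μ) p volume ∧
      negSobolevNormIco p μ = eLpNorm (discrepancy μ) p volume := by
  set σ : UnitIco → ℝ := (↑) with hσ
  have e : IcoParam fractIco σ := icoParam_unitIco
  have := e.isProbabilityMeasure
  have := e.isProbabilityMeasure_map μ
  set m := μ.map σ with hm
  have hd : discrepancy μ = fun x => quasiCdf m (σ x) - σ x - 0 := by
    ext x
    rw [sub_zero]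
    exact (map_coe_Iio μ x).symm
  have hd' : eLpNorm (discrepancy μ) p volume =
      eLpNorm (fun t => quasiCdf m t - t - 0) p (volume.restrict (Set.Ico 0 1)) := by
    rw [hd, ← e.eLpNorm_comp]
  set τ : UnitIco → UnitIco := fun x => fractIco (quasiQuantile m (σ x)) with hτdef
  have hτ : MeasurePreserving τ volume μ := e.measurePreserving_quantile μ
  have hστ : ∀ u, σ (τ u) = quasiQuantile m (σ u + 0) := by
    intro u
    rw [add_zero]
    exact e.coord_param _ (quasiQuantile_mem_Ico (e.map_compl μ) (e.coord_mem u))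
  have hdist : ∀ x y : UnitIco, dist x y ≤ 1 := by
    intro x y
    rw [Subtype.dist_eq, Real.dist_eq, abs_le]
    constructor <;> linarith [x.2.1, x.2.2, y.2.1, y.2.2]
  have hmeas : ∀ f g, HasWeakDerivIco f g → AEStronglyMeasurable g volume :=
    fun f g h => h.aestronglyMeasurable
  -- The interval admits no shift, so the compact set of shifts is `{0}`.
  have lower : ∀ A : ℝ≥0∞ → ℝ≥0∞, (∀ p, 1 ≤ p → A p ≤ A ⊤) → (∀ r : ℝ, 1 < r →
      eLpNorm (fun t => quasiCdf m t - t - 0) (ENNReal.ofReal r)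
        (volume.restrict (Set.Ico 0 1)) ≤ A (ENNReal.ofReal r) ∧
      eLpNorm (fun t => quasiCdf m t - t - 0) (ENNReal.ofReal r)
        (volume.restrict (Set.Ico 0 1)) ^ r ≤ 2 ^ (r - 1) * A 1) →
      eLpNorm (discrepancy μ) p volume ≤ A p := by
    intro A hA h
    have := iInf_eLpNorm_sub_le (f := fun t => quasiCdf m t - t)
      ((measurable_quasiCdf m).sub measurable_id).aestronglyMeasurable
      (fun t => abs_quasiCdf_sub_le t) (isCompact_singleton (x := (0 : ℝ))) two_ne_zero
      ENNReal.ofNat_ne_top hA (fun r hr => ⟨0, rfl, h r hr⟩) hp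
    rw [hd']
    simpa using this
  constructor
  · refine le_antisymm ?_ (lower (fun p => wasserstein p μ volume)
      (fun p _ => wasserstein_mono le_top) fun r hr => ?_)
    · rw [hd]
      refine e.wasserstein_le_eLpNorm μ 0 hτ (fun u => le_of_eq ?_) hp
      rw [Subtype.dist_eq, Real.dist_eq, ← hστ u]
    · refine e.eLpNorm_le_wasserstein μ hdist (by simp) hr hτ fun x u => ?_
      have := ((inversePair_quasiCdf (m := m)).translate 0).potential_add_le hr (σ x) (σ u)
      rw [hστ u, Subtype.dist_eq, Real.dist_eq]
      exact this
  · refine le_antisymm ?_ (lower (fun p => negSobolevNorm HasWeakDerivIco p μ)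
      (fun p _ => negSobolevNorm_mono_top hmeas μ p) fun r hr => ?_)
    · rw [hd]
      exact negSobolevNorm_le_eLpNorm e hmeas
        (fun f g hf h hg => ⟨h.eq_add_primitive hf hg, zero_mul _⟩) μ hp
    · exact eLpNorm_le_negSobolevNorm e (z := 0) (mul_zero _)
        (fun g hg _ => hasWeakDerivIco_primitive hg) μ (by simp) hr (zero_mul _)

end Ico

/-! ### The circle -/

/-- The representative in `[0, 1)` of a point of the circle. -/
noncomputable def circleCoord (x : UnitAddCircle) : ℝ := AddCircle.equivIco 1 0 x

theorem circleCoord_coe (t : ℝ) : circleCoord (t : UnitAddCircle) = Int.fract t := by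
  have := AddCircle.coe_equivIco_mk_apply (1 : ℝ) t
  rw [div_one, mul_one] at this
  exact this

theorem coe_circleCoord (x : UnitAddCircle) : (circleCoord x : UnitAddCircle) = x :=
  AddCircle.coe_equivIco

theorem circleCoord_mem (x : UnitAddCircle) : circleCoord x ∈ Set.Ico (0 : ℝ) 1 := by
  have h := (AddCircle.equivIco (1 : ℝ) 0 x).2
  exact ⟨h.1, h.2.trans_eq (zero_add _)⟩

theorem icoParam_circle : IcoParam (fun t : ℝ => (t : UnitAddCircle)) circleCoord where
  measurable_param := AddCircle.measurable_mk'
  measurable_coord := measurable_subtype_coe.comp (AddCircle.measurableEquivIco 1 0).measurable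
  map_coord := by
    have hσ : Measurable circleCoord :=
      measurable_subtype_coe.comp (AddCircle.measurableEquivIco 1 0).measurable
    have h := UnitAddCircle.measurePreserving_mk 0
    rw [zero_add, ← restrict_Ico_eq_restrict_Ioc] at h
    rw [← h.map_eq, Measure.map_map hσ h.measurable]
    refine (Measure.map_congr ?_).trans Measure.map_id
    refine (ae_restrict_iff' measurableSet_Ico).2 (Filter.Eventually.of_forall fun t ht => ?_)
    exact (circleCoord_coe t).trans (Int.fract_eq_self.2 ht)
  coord_mem := circleCoord_mem
  param_coord := coe_circleCoord
  coord_param t ht := (circleCoord_coe t).trans (Int.fract_eq_self.2 ht)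

/-- The periodization of a test function supported in `(0, 1)` is locally a translate of it. -/
theorem eventually_comp_fract_eq {φ : ℝ → ℝ} (hs : tsupport φ ⊆ Set.Ioo 0 1) (x : ℝ) :
    (fun z => φ (Int.fract z)) =ᶠ[nhds x] fun z => φ (z - ⌊x⌋) := by
  have hnear : ∀ a : ℝ, a ∉ Set.Ioo (0 : ℝ) 1 → ∀ᶠ z in nhds a, φ z = 0 := by
    intro a ha
    have h1 : (tsupport φ)ᶜ ∈ nhds a :=
      (isClosed_tsupport φ).isOpen_compl.mem_nhds fun h => ha (hs h)
    filter_upwards [h1] with z hz using image_eq_zero_of_notMem_tsupport hz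
  have hlt : ∀ᶠ z in nhds x, z < (⌊x⌋ : ℝ) + 1 := gt_mem_nhds (Int.lt_floor_add_one x)
  -- At an integer the fractional part jumps, but `φ` vanishes near both `0` and `1`, so to the left
  -- of `x` both sides are `0`.
  rcases (Int.floor_le x).eq_or_lt with hx | hx
  · have h0 : Filter.Tendsto (fun z => z - (⌊x⌋ : ℝ)) (nhds x) (nhds 0) :=
      (continuous_id.sub continuous_const).tendsto' _ _ (by simp [hx])
    have h1 : Filter.Tendsto (fun z => z - (⌊x⌋ : ℝ) + 1) (nhds x) (nhds 1) :=
      ((continuous_id.sub continuous_const).add continuous_const).tendsto' _ _ (by simp [hx])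
    have hgt : ∀ᶠ z in nhds x, (⌊x⌋ : ℝ) - 1 < z := lt_mem_nhds (by linarith)
    filter_upwards [h0.eventually (hnear 0 (by simp)), h1.eventually (hnear 1 (by simp)), hlt, hgt]
      with z hz0 hz1 hz2 hz3
    rcases le_or_gt (⌊x⌋ : ℝ) z with h | h
    · have : ⌊z⌋ = ⌊x⌋ := Int.floor_eq_iff.2 ⟨h, hz2⟩
      rw [Int.fract, this]
    · have : ⌊z⌋ = ⌊x⌋ - 1 := Int.floor_eq_iff.2 ⟨by push_cast; linarith, by push_cast; linarith⟩
      rw [Int.fract, this, hz0]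
      push_cast
      rw [← hz1]
      congr 1
      ring
  · filter_upwards [hlt, lt_mem_nhds hx] with z hz1 hz2
    have : ⌊z⌋ = ⌊x⌋ := Int.floor_eq_iff.2 ⟨hz2.le, hz1⟩
    rw [Int.fract, this]

/-- It makes every test function on `(0, 1)` a test function on the circle, so the interval lemmas
on weak derivatives apply after cutting the circle at `0`. -/
theorem isSmoothWithDerivCircle_periodization {φ : ℝ → ℝ} (hφ : ContDiff ℝ ∞ φ)
    (hs : tsupport φ ⊆ Set.Ioo 0 1) :
    IsSmoothWithDerivCircle (fun x => φ (circleCoord x)) (fun x => deriv φ (circleCoord x)) := by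
  simp only [IsSmoothWithDerivCircle, circleCoord_coe]
  constructor
  · rw [contDiff_iff_contDiffAt]
    intro x
    exact (hφ.comp (contDiff_id.sub contDiff_const)).contDiffAt.congr_of_eventuallyEq
      (eventually_comp_fract_eq hs x)
  · intro x
    refine HasDerivAt.congr_of_eventuallyEq ?_ (eventually_comp_fract_eq hs x)
    exact ((hφ.differentiable (by simp) _).hasDerivAt).comp_sub_const x (⌊x⌋ : ℝ)

theorem IsSmoothWithDerivCircle.continuous_deriv {φ φ' : UnitAddCircle → ℝ}
    (h : IsSmoothWithDerivCircle φ φ') : Continuous fun t : ℝ => φ' (t : UnitAddCircle) := by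
  have h1 : deriv (fun y : ℝ => φ (y : UnitAddCircle)) = fun t : ℝ => φ' (t : UnitAddCircle) :=
    funext fun t => (h.2 t).deriv
  rw [← h1]
  exact h.1.continuous_deriv (by simp)

theorem integral_mul_comp_circleCoord (f : UnitAddCircle → ℝ) (φ : ℝ → ℝ) :
    ∫ x : UnitAddCircle, f x * φ (circleCoord x) =
      ∫ t in Set.Ico (0 : ℝ) 1, f (t : UnitAddCircle) * φ t := by
  rw [icoParam_circle.integral_eq]
  refine setIntegral_congr_fun measurableSet_Ico fun t ht => ?_
  simp only [icoParam_circle.coord_param t ht]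

/-- The constant `1` is an admissible test function on the circle. -/
theorem HasWeakDerivCircle.integral_eq_zero {f g : UnitAddCircle → ℝ}
    (h : HasWeakDerivCircle f g) : ∫ x, g x = 0 := by
  have := h.2.2 (fun _ => 1) (fun _ => 0) ⟨contDiff_const, fun x => hasDerivAt_const _ _⟩
  simpa using this

theorem HasWeakDerivCircle.eq_add_primitive {f g : UnitAddCircle → ℝ} (hf : Continuous f)
    (h : HasWeakDerivCircle f g) (hg : Integrable g) :
    ∀ x ∈ Set.Ico (0 : ℝ) 1, f (x : UnitAddCircle) =
      f ((0 : ℝ) : UnitAddCircle) + ∫ t in (0 : ℝ)..x, g (t : UnitAddCircle) := by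
  refine eq_add_primitive_of_weakDeriv (hf.comp (AddCircle.continuous_mk' 1)).continuousOn
    ((icoParam_circle.integrable_iff g).1 hg) fun φ hφ hc hs => ?_
  have := h.2.2 _ _ (isSmoothWithDerivCircle_periodization hφ hs)
  rwa [integral_mul_comp_circleCoord, integral_mul_comp_circleCoord] at this

theorem integrable_comp_circleCoord {g : ℝ → ℝ} (hg : IntegrableOn g (Set.Ioc 0 1)) :
    Integrable fun x => g (circleCoord x) := by
  rw [icoParam_circle.integrable_iff]
  rw [IntegrableOn, ← restrict_Ico_eq_restrict_Ioc] at hg ⊢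
  refine (integrable_congr ?_).2 hg
  refine (ae_restrict_iff' measurableSet_Ico).2 (Filter.Eventually.of_forall fun t ht => ?_)
  simp only [icoParam_circle.coord_param t ht]

/-- Mean zero makes the primitive close up at `0`, which gives continuity, and removes the boundary
term in the integration by parts. -/
theorem hasWeakDerivCircle_primitive {g : ℝ → ℝ} (hg : IntegrableOn g (Set.Ioc 0 1))
    (hg0 : ∫ t in (0 : ℝ)..1, g t = 0) :
    Continuous (fun x => ∫ t in (0 : ℝ)..(circleCoord x), g t) ∧
      HasWeakDerivCircle (fun x => ∫ t in (0 : ℝ)..(circleCoord x), g t)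
        (fun x => g (circleCoord x)) := by
  have hcont : Continuous (fun x => ∫ t in (0 : ℝ)..(circleCoord x), g t) := by
    refine AddCircle.liftIco_continuous (p := (1 : ℝ)) (a := 0)
      (f := fun x => ∫ t in (0 : ℝ)..x, g t) ?_ ?_
    · simp [hg0]
    · rw [zero_add]
      exact continuousOn_primitive_Icc hg
  refine ⟨hcont, hcont.locallyIntegrable, (integrable_comp_circleCoord hg).locallyIntegrable,
    fun φ φ' hφ => ?_⟩
  have h1 := integral_primitive_mul_deriv hg hφ.2 hφ.continuous_deriv
  rw [hg0, mul_zero, zero_sub, intervalIntegral_eq_integral_Ico] at h1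
  have e1 := integral_mul_comp_circleCoord φ' fun t => ∫ s in (0 : ℝ)..t, g s
  have e2 := integral_mul_comp_circleCoord φ g
  simp only [mul_comm (φ' _)] at e1
  simp only [mul_comm (φ _)] at e2
  rw [e1, e2, h1]

/-- The periodic discrepancy function is an antiderivative of `μ - λ`. -/
theorem isAntiderivCircle_quasiCdf (μ : Measure UnitAddCircle) [IsProbabilityMeasure μ] :
    IsAntiderivCircle (fun x => quasiCdf (μ.map circleCoord) (circleCoord x) - circleCoord x) μ := by
  have e := icoParam_circle
  have := e.isProbabilityMeasure_map μ
  set m := μ.map circleCoord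
  refine ⟨?_, fun φ φ' h => ?_⟩
  · refine Integrable.of_bound (C := 1) (Measurable.aestronglyMeasurable ?_)
      (Filter.Eventually.of_forall fun x => abs_quasiCdf_sub_le _)
    exact ((measurable_quasiCdf m).comp e.measurable_coord).sub e.measurable_coord
  · have hg : IntegrableOn (fun t : ℝ => φ' (t : UnitAddCircle)) (Set.Ioc 0 1) :=
      h.continuous_deriv.integrableOn_Ioc
    have h1 := integral_sub_integral_primitive (e.map_compl μ)
      (f := fun t : ℝ => φ (t : UnitAddCircle)) hg fun x _ => by
        rw [intervalIntegral.integral_eq_sub_of_hasDerivAt (fun t _ => h.2 t)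
          (h.continuous_deriv.intervalIntegrable _ _)]
        ring
    rw [e.measurableEmbedding.integral_map, ← e.integral_eq] at h1
    simp only [coe_circleCoord] at h1
    have e1 := integral_mul_comp_circleCoord φ' fun t => quasiCdf m t - t
    simp only [mul_comm (φ' _)] at e1
    rw [h1, neg_neg, e1, intervalIntegral_eq_integral_Ico]

/-- Antiderivatives on the circle are unique up to constants. -/
theorem IsAntiderivCircle.ae_eq_add_const {μ : Measure UnitAddCircle} {F G : UnitAddCircle → ℝ}
    (hF : IsAntiderivCircle F μ) (hG : IsAntiderivCircle G μ) :
    ∃ c : ℝ, ∀ᵐ x, F x = G x + c := by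
  have e := icoParam_circle
  have hw : Integrable fun x => F x - G x := hF.1.sub hG.1
  have hwl : LocallyIntegrableOn (fun t : ℝ => F (t : UnitAddCircle) - G (t : UnitAddCircle))
      (Set.Ioo 0 1) :=
    (((e.integrable_iff _).1 hw).mono_set Set.Ioo_subset_Ioc_self).locallyIntegrableOn
  obtain ⟨c, hc⟩ := ae_eq_const_of_forall_integral_mul_deriv_eq_zero hwl fun φ hφ _ hs => by
    have hsm := isSmoothWithDerivCircle_periodization hφ hs
    have hd : Continuous (deriv φ) := hφ.continuous_deriv (by simp)
    obtain ⟨C, hC⟩ := isCompact_Icc.exists_bound_of_continuousOn (hd.continuousOn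
      (s := Set.Icc 0 1))
    have hb : ∀ H : UnitAddCircle → ℝ, Integrable H →
        Integrable fun x => H x * deriv φ (circleCoord x) := by
      intro H hH
      refine hH.mul_bdd (c := C) (hd.measurable.comp e.measurable_coord).aestronglyMeasurable
        (Filter.Eventually.of_forall fun x => ?_)
      exact hC _ (Set.Ico_subset_Icc_self (circleCoord_mem x))
    have h1 : ∫ x, (F x - G x) * deriv φ (circleCoord x) = 0 := by
      simp only [sub_mul]
      rw [integral_sub (hb F hF.1) (hb G hG.1), hF.2 _ _ hsm, hG.2 _ _ hsm, sub_self]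
    rw [integral_mul_comp_circleCoord (fun x => F x - G x)] at h1
    rw [← h1, setIntegral_eq_integral_of_forall_compl_eq_zero]
    intro t ht
    rw [image_eq_zero_of_notMem_tsupport fun hn => ht (Set.Ioo_subset_Ico_self
      (hs (tsupport_deriv_subset hn))), mul_zero]
  refine ⟨c, ?_⟩
  have h1 : ∀ᵐ t : ℝ ∂((volume : Measure UnitAddCircle).map circleCoord),
      F (t : UnitAddCircle) - G (t : UnitAddCircle) = c := by
    rw [e.map_coord, ← restrict_Ioo_eq_restrict_Ico]
    exact (ae_restrict_iff' measurableSet_Ioo).2 hc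
  rw [e.measurableEmbedding.ae_map_iff] at h1
  filter_upwards [h1] with x hx
  rw [coe_circleCoord] at hx
  linarith

theorem periodic_map_circleCoord {f : ℝ → ℝ} (hf : Function.Periodic f 1) (t : ℝ) :
    f (circleCoord (t : UnitAddCircle)) = f t := by
  rw [circleCoord_coe, Int.fract]
  simpa using hf.sub_int_mul_eq (x := t) ⌊t⌋

/-- The formulas for the Wasserstein distance and the negative Sobolev norm on the circle. -/
theorem wasserstein_eq_iInf_eLpNorm {p : ℝ≥0∞} (hp : 1 ≤ p) (μ : Measure UnitAddCircle)
    [IsProbabilityMeasure μ] :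
    wasserstein p μ volume = ⨅ y : ℝ, eLpNorm
        (fun x => quasiCdf (μ.map circleCoord) (circleCoord x) - circleCoord x - y) p volume ∧
      negSobolevNormCircle p μ = ⨅ y : ℝ, eLpNorm
        (fun x => quasiCdf (μ.map circleCoord) (circleCoord x) - circleCoord x - y) p volume := by
  have e := icoParam_circle
  have := e.isProbabilityMeasure_map μ
  have := e.isProbabilityMeasure
  have hmeas : ∀ f g, HasWeakDerivCircle f g → AEStronglyMeasurable g volume :=
    fun f g h => h.2.1.aestronglyMeasurable
  have hdist : ∀ x y : UnitAddCircle, dist x y ≤ 1 := by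
    intro x y
    rw [dist_eq_norm]
    refine (AddCircle.norm_le_half_period 1 one_ne_zero).trans ?_
    norm_num
  set m := μ.map circleCoord with hm
  have hpair := inversePair_quasiCdf (m := m)
  have hnorm : ∀ y : ℝ, eLpNorm (fun x => quasiCdf m (circleCoord x) - circleCoord x - y) p volume =
      eLpNorm (fun t => quasiCdf m t - t - y) p (volume.restrict (Set.Ico 0 1)) :=
    fun y => e.eLpNorm_comp (fun t => quasiCdf m t - t - y) p
  -- Rotation by `y` followed by the quantile map; the rotation preserves the uniform measure.
  set τ : ℝ → UnitAddCircle → UnitAddCircle :=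
    fun y x => (quasiQuantile m (circleCoord (x + (y : UnitAddCircle))) : ℝ) with hτdef
  have hτ : ∀ y, MeasurePreserving (τ y) volume μ := fun y =>
    (e.measurePreserving_quantile μ).comp
      (measurePreserving_add_right volume (y : UnitAddCircle))
  have hττ : ∀ y u, τ y u = (quasiQuantile m (circleCoord u + y) : ℝ) := by
    intro y u
    have hper : Function.Periodic (fun t => ((quasiQuantile m t : ℝ) : UnitAddCircle)) 1 := by
      intro t
      simp only
      rw [hpair.right_add_one, AddCircle.coe_add]
      simp
    have h1 : circleCoord (u + (y : UnitAddCircle)) = Int.fract (circleCoord u + y) := by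
      rw [← circleCoord_coe, AddCircle.coe_add, coe_circleCoord]
    simp only [hτdef, h1, Int.fract]
    -- As `T` commutes with integer translations, reducing `circleCoord u + y` modulo `1` does not
    -- change the image on the circle.
    simpa only [mul_one] using hper.sub_int_mul_eq (x := circleCoord u + y) ⌊circleCoord u + y⌋
  have hsign : ∀ r y : ℝ, ∫ t in (0 : ℝ)..1, signedPow r (t - (quasiCdf m t - y)) =
      -∫ t in (0 : ℝ)..1, signedPow r (quasiCdf m t - t - y) := by
    intro r y
    rw [← intervalIntegral.integral_neg]
    refine intervalIntegral.integral_congr fun t _ => ?_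
    rw [← signedPow_neg]
    congr 1
    ring
  have lower : ∀ A : ℝ≥0∞ → ℝ≥0∞, (∀ p, 1 ≤ p → A p ≤ A ⊤) → (∀ (r y : ℝ), 1 < r → |y| ≤ 1 →
      ∫ t in (0 : ℝ)..1, signedPow r (quasiCdf m t - t - y) = 0 →
      eLpNorm (fun t => quasiCdf m t - t - y) (ENNReal.ofReal r)
        (volume.restrict (Set.Ico 0 1)) ≤ A (ENNReal.ofReal r) ∧
      eLpNorm (fun t => quasiCdf m t - t - y) (ENNReal.ofReal r)
        (volume.restrict (Set.Ico 0 1)) ^ r ≤ 2 ^ (r - 1) * A 1) →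
      ⨅ y : ℝ, eLpNorm (fun x => quasiCdf m (circleCoord x) - circleCoord x - y) p volume ≤
        A p := by
    intro A hA h
    have := iInf_eLpNorm_sub_le (P := volume.restrict (Set.Ico (0 : ℝ) 1)) (f := fun t => quasiCdf m t - t)
      ((measurable_quasiCdf m).sub measurable_id).aestronglyMeasurable
      (fun t => abs_quasiCdf_sub_le t) (isCompact_Icc (a := (-1 : ℝ)) (b := 1)) two_ne_zero
      ENNReal.ofNat_ne_top hA (fun r hr => ?_) hp
    · refine le_trans ?_ this
      refine le_iInf₂ fun y _ => ?_
      rw [← hnorm]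
      exact iInf_le _ y
    -- The bound `1 + |Φ 0|` on the shift is `1`, because `Φ 0 = 0`; hence the compact set `[-1,
    -- 1]`.
    · obtain ⟨y, hy, h0⟩ := hpair.exists_integral_signedPow_eq_zero hr
      rw [quasiCdf_zero (e.map_compl μ), abs_zero, add_zero] at hy
      rw [hsign, neg_eq_zero] at h0
      exact ⟨y, abs_le.1 hy, h r y hr hy h0⟩
  constructor
  · refine le_antisymm (le_iInf fun y => ?_) (lower (fun p => wasserstein p μ volume)
      (fun p _ => wasserstein_mono le_top) fun r y hr hy h0 => ?_)
    · refine e.wasserstein_le_eLpNorm μ y (hτ y) (fun u => ?_) hp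
      rw [hττ]
      nth_rw 2 [← coe_circleCoord u]
      rw [dist_eq_norm, ← AddCircle.coe_sub, UnitAddCircle.norm_eq]
      simpa using round_le (quasiQuantile m (circleCoord u + y) - circleCoord u) 0
    · refine e.eLpNorm_le_wasserstein μ hdist hy hr (hτ y) fun x u => ?_
      have hpy := hpair.translate y
      have hperiodic := hpy.potential_periodic hr (by rw [hsign, h0, neg_zero])
      -- Translating by `n` picks the lift of `x` nearest to that of `u`, so the circle distance
      -- becomes an absolute value and the inequality on the line applies; the periodic potential
      -- does not see `n`.
      set n := round (circleCoord x - circleCoord u)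
      have h1 := hpy.potential_add_le hr (circleCoord x - n) (circleCoord u)
      have h2 : dist x u = |circleCoord x - n - circleCoord u| := by
        rw [dist_eq_norm, sub_right_comm, ← UnitAddCircle.norm_eq, AddCircle.coe_sub,
          coe_circleCoord, coe_circleCoord]
      have h3 := hperiodic.sub_int_mul_eq (x := circleCoord x) n
      rw [mul_one] at h3
      rw [hττ, periodic_map_circleCoord hperiodic, h2, ← h3]
      exact h1
  · refine le_antisymm (le_iInf fun y => ?_) (lower (fun p => negSobolevNorm HasWeakDerivCircle p μ)
      (fun p _ => negSobolevNorm_mono_top hmeas μ p) fun r y hr hy h0 => ?_)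
    · exact negSobolevNorm_le_eLpNorm e hmeas
        (fun f g hf h hg => ⟨h.eq_add_primitive hf hg, by rw [h.integral_eq_zero, mul_zero]⟩) μ hp
    · refine eLpNorm_le_negSobolevNorm e (z := 1) (mul_one _)
        (fun g hg h => hasWeakDerivCircle_primitive hg (by simpa using h)) μ hy hr ?_
      rw [one_mul, h0]

theorem IsAntiderivCircle.iInf_eLpNorm_sub {μ : Measure UnitAddCircle} {F G : UnitAddCircle → ℝ}
    (hF : IsAntiderivCircle F μ) (hG : IsAntiderivCircle G μ) (p : ℝ≥0∞) :
    ⨅ y : ℝ, eLpNorm (fun x => F x - y) p volume = ⨅ y : ℝ, eLpNorm (fun x => G x - y) p volume := by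
  obtain ⟨c, hc⟩ := hF.ae_eq_add_const hG
  refine (Equiv.subRight c).iInf_congr fun y => ?_
  refine eLpNorm_congr_ae ?_
  filter_upwards [hc] with x hx
  rw [hx, Equiv.subRight_apply]
  ring

end WassersteinSobolev

theorem proposition1p2 (p : ℝ≥0∞) (hp : 1 ≤ p) :
    (∀ (μ : Measure WassersteinSobolev.UnitIco) [IsProbabilityMeasure μ],
      WassersteinSobolev.wasserstein p μ volume = WassersteinSobolev.negSobolevNormIco p μ ∧
      WassersteinSobolev.negSobolevNormIco p μ =
        eLpNorm (WassersteinSobolev.discrepancy μ) p volume) ∧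
    (∀ (μ : Measure UnitAddCircle) [IsProbabilityMeasure μ],
      WassersteinSobolev.wasserstein p μ volume = WassersteinSobolev.negSobolevNormCircle p μ ∧
      (∃ F : UnitAddCircle → ℝ, WassersteinSobolev.IsAntiderivCircle F μ) ∧
      ∀ F : UnitAddCircle → ℝ, WassersteinSobolev.IsAntiderivCircle F μ →
        WassersteinSobolev.negSobolevNormCircle p μ =
          ⨅ y : ℝ, eLpNorm (fun x => F x - y) p volume) := by
  constructor
  · intro μ _
    obtain ⟨h1, h2⟩ := WassersteinSobolev.wasserstein_eq_eLpNorm_discrepancy hp μ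
    exact ⟨h1.trans h2.symm, h2⟩
  · intro μ _
    obtain ⟨h1, h2⟩ := WassersteinSobolev.wasserstein_eq_iInf_eLpNorm hp μ
    have hF := WassersteinSobolev.isAntiderivCircle_quasiCdf μ
    exact ⟨h1.trans h2.symm, ⟨_, hF⟩, fun F hF' => h2.trans (hF.iInf_eLpNorm_sub hF' p)⟩
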